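/- Let $w=(w_i)_{i\ge1}$ be an admissible sequence, i.e. a decreasing (non-increasing) sequence of nonnegative real numbers with $w_1=1$, $\lim_i w_i=0$ and $\sum_i w_i=\infty$, and put $W(n)=\sum_{i=1}^n w_i$. Let $\mathbb K=\mathbb R$ or $\mathbb C$. Let $d_*(w,1)$ be the space of all bounded sequences $x$ of elements of $\mathbb K$ such that $\lim_{n}\frac1{W(n)}\sum_{i=1}^n x^*(i)=0$, where $x^*$ is the decreasing rearrangement of $(|x(i)|)_i$, with the norm $\|x\|_W=\sup_{n\ge1}\frac1{W(n)}\sum_{i=1}^n x^*(i)$. For $N\ge1$ let $\mathcal P_N(d_*(w,1))$ be the space of all continuous scalar-valued polynomials $P=P_0+\cdots+P_N$ of degree at most $N$ on $d_*(w,1)$, where $P_j(x)=\Phi_j(x,\dots,x)$ for a continuous $j$-linear form $\Phi_j$, with the norm $\|P\|=\sup_{\|x\|_W\le1}|P(x)|$. Call $P$ norm attaining if $|P(x_0)|=\|P\|$ for some $x_0$ with $\|x_0\|_W\le1$, and let $NA\mathcal P_N(d_*(w,1))$ be the set of norm-attaining elements of $\mathcal P_N(d_*(w,1))$. Then $NA\mathcal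 P_N(d_*(w,1))$ is norm dense in $\mathcal P_N(d_*(w,1))$ if and only if $w\notin\ell_N$. -/

import Mathlib

open Filter Topology

/-- An admissible sequence `w = (w₁, w₂, …)`, indexed here from `0`: a decreasing sequence of
nonnegative reals with first term `1`, limit `0` and divergent sum. -/
structure AdmissibleSeq where
  seq : ℕ → ℝ
  antitone : Antitone seq
  nonneg : ∀ i, 0 ≤ seq i
  first : seq 0 = 1
  tendsto_zero : Tendsto seq atTop (𝓝 0)
  not_summable : ¬ Summable seq

/-- The partial sums `W(n) = w₁ + ⋯ + wₙ`. -/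
noncomputable def AdmissibleSeq.W (w : AdmissibleSeq) (n : ℕ) : ℝ :=
  ∑ i ∈ Finset.range n, w.seq i

theorem AdmissibleSeq.W_pos (w : AdmissibleSeq) (n : ℕ) : 0 < w.W (n + 1) := by
  have h : w.seq 0 ≤ ∑ i ∈ Finset.range (n + 1), w.seq i :=
    Finset.single_le_sum (fun i _ => w.nonneg i) (by simp)
  have h1 := w.first
  unfold AdmissibleSeq.W
  linarith

section Rearrangement

variable {𝕜 : Type*} [RCLike 𝕜]

/-- The decreasing rearrangement `x*` of a bounded sequence `x`, indexed from `0`: `x*(n)` is the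
infimum of the `t ≥ 0` such that at most `n` terms of `x` have modulus greater than `t`. -/
noncomputable def decRearrangement (x : ℕ → 𝕜) (n : ℕ) : ℝ :=
  sInf {t : ℝ | 0 ≤ t ∧ {i : ℕ | t < ‖x i‖}.encard ≤ n}

/-- `x*(1) + ⋯ + x*(n)`, the sum of the first `n` terms of the decreasing rearrangement. -/
noncomputable def rearrangementSum (x : ℕ → 𝕜) (n : ℕ) : ℝ :=
  ∑ i ∈ Finset.range n, decRearrangement x i

theorem decRearrangement_nonneg (x : ℕ → 𝕜) (n : ℕ) : 0 ≤ decRearrangement x n :=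
  Real.sInf_nonneg fun _ ht => ht.1

theorem rearrangementSum_nonneg (x : ℕ → 𝕜) (n : ℕ) : 0 ≤ rearrangementSum x n :=
  Finset.sum_nonneg fun i _ => decRearrangement_nonneg x i

theorem lt_encard_of_lt_decRearrangement (x : ℕ → 𝕜) (n : ℕ) {t : ℝ}
    (ht : t < decRearrangement x n) : (n : ℕ∞) < {i : ℕ | t < ‖x i‖}.encard := by
  by_contra hcon
  rcases lt_or_ge t 0 with h0 | h0
  · have : {i : ℕ | t < ‖x i‖} = Set.univ := by
      ext i
      simpa using lt_of_lt_of_le h0 (norm_nonneg _)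
    rw [this, Set.encard_univ] at hcon
    simp at hcon
  · have hb : BddBelow {t : ℝ | 0 ≤ t ∧ {i : ℕ | t < ‖x i‖}.encard ≤ n} := ⟨0, fun s hs => hs.1⟩
    exact absurd (csInf_le hb ⟨h0, not_lt.mp hcon⟩) (not_le.mpr ht)

theorem le_decRearrangement {x : ℕ → 𝕜} {C : ℝ} (hC : ∀ i, ‖x i‖ ≤ C) (n : ℕ) {A : Finset ℕ}
    (hA : n < A.card) {r : ℝ} (hr : ∀ i ∈ A, r ≤ ‖x i‖) : r ≤ decRearrangement x n := by
  refine le_csInf ⟨C, (norm_nonneg _).trans (hC 0), ?_⟩ ?_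
  · have : {i : ℕ | C < ‖x i‖} = ∅ := by
      ext i
      simpa using hC i
    simp [this]
  · rintro t ⟨-, ht⟩
    by_contra hlt
    have hsub : (A : Set ℕ) ⊆ {i : ℕ | t < ‖x i‖} :=
      fun i hi => lt_of_lt_of_le (not_le.mp hlt) (hr i hi)
    have h := (Set.encard_le_encard hsub).trans ht
    rw [Set.encard_coe_eq_coe_finsetCard] at h
    exact absurd (Nat.cast_le.mp h) (not_le.mpr hA)

theorem sum_le_rearrangementSum {x : ℕ → 𝕜} {C : ℝ} (hC : ∀ i, ‖x i‖ ≤ C) :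
    ∀ (n : ℕ) (A : Finset ℕ), A.card = n → ∑ i ∈ A, ‖x i‖ ≤ rearrangementSum x n := by
  intro n
  induction n with
  | zero =>
    intro A hA
    simp [Finset.card_eq_zero.mp hA, rearrangementSum]
  | succ n ih =>
    intro A hA
    have hne : A.Nonempty := Finset.card_pos.mp (by omega)
    obtain ⟨j, hj, hmin⟩ := A.exists_min_image (fun i => ‖x i‖) hne
    have h1 : ‖x j‖ ≤ decRearrangement x n := le_decRearrangement hC n (by omega) hmin
    have h2 := ih (A.erase j) (by rw [Finset.card_erase_of_mem hj]; omega)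
    rw [← Finset.sum_erase_add A _ hj, rearrangementSum, Finset.sum_range_succ]
    exact add_le_add h2 h1

theorem exists_rearrangementSum_le (x : ℕ → 𝕜) {ε : ℝ} (hε : 0 < ε) (n : ℕ) :
    ∃ A : Finset ℕ, A.card = n ∧ rearrangementSum x n ≤ ∑ i ∈ A, ‖x i‖ + n * ε := by
  induction n with
  | zero => exact ⟨∅, by simp [rearrangementSum]⟩
  | succ n ih =>
    obtain ⟨A, hA, hle⟩ := ih
    have hlt := lt_encard_of_lt_decRearrangement x n (sub_lt_self (decRearrangement x n) hε)
    obtain ⟨j, hj, hjA⟩ : ∃ j, decRearrangement x n - ε < ‖x j‖ ∧ j ∉ A := by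
      by_contra! hcon
      have hsub : {i : ℕ | decRearrangement x n - ε < ‖x i‖} ⊆ (A : Set ℕ) := fun i hi => hcon i hi
      have h := Set.encard_le_encard hsub
      rw [Set.encard_coe_eq_coe_finsetCard, hA] at h
      exact absurd h (not_le.mpr hlt)
    refine ⟨insert j A, by rw [Finset.card_insert_of_notMem hjA, hA], ?_⟩
    rw [Finset.sum_insert hjA, rearrangementSum, Finset.sum_range_succ]
    rw [rearrangementSum] at hle
    push_cast
    linarith

theorem rearrangementSum_le_of_forall (x : ℕ → 𝕜) (n : ℕ) {r : ℝ}
    (h : ∀ A : Finset ℕ, A.card = n → ∑ i ∈ A, ‖x i‖ ≤ r) : rearrangementSum x n ≤ r := by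
  refine le_of_forall_pos_le_add fun ε hε => ?_
  have hn : (0 : ℝ) < n + 1 := by positivity
  obtain ⟨A, hA, hle⟩ := exists_rearrangementSum_le x (div_pos hε hn) n
  have h1 : (n : ℝ) * (ε / (n + 1)) ≤ ε := by
    rw [mul_div_assoc', div_le_iff₀ hn]
    nlinarith
  linarith [h A hA]

theorem rearrangementSum_add_le {x y : ℕ → 𝕜} {C D : ℝ} (hC : ∀ i, ‖x i‖ ≤ C)
    (hD : ∀ i, ‖y i‖ ≤ D) (n : ℕ) :
    rearrangementSum (x + y) n ≤ rearrangementSum x n + rearrangementSum y n := by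
  refine rearrangementSum_le_of_forall _ n fun A hA => ?_
  calc ∑ i ∈ A, ‖(x + y) i‖ ≤ ∑ i ∈ A, (‖x i‖ + ‖y i‖) :=
        Finset.sum_le_sum fun i _ => norm_add_le _ _
    _ = ∑ i ∈ A, ‖x i‖ + ∑ i ∈ A, ‖y i‖ := Finset.sum_add_distrib
    _ ≤ _ := add_le_add (sum_le_rearrangementSum hC n A hA) (sum_le_rearrangementSum hD n A hA)

theorem rearrangementSum_smul_le (c : 𝕜) {x : ℕ → 𝕜} {C : ℝ} (hC : ∀ i, ‖x i‖ ≤ C) (n : ℕ) :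
    rearrangementSum (c • x) n ≤ ‖c‖ * rearrangementSum x n := by
  refine rearrangementSum_le_of_forall _ n fun A hA => ?_
  calc ∑ i ∈ A, ‖(c • x) i‖ = ‖c‖ * ∑ i ∈ A, ‖x i‖ := by
        rw [Finset.mul_sum]
        exact Finset.sum_congr rfl fun i _ => norm_smul c (x i)
    _ ≤ _ := mul_le_mul_of_nonneg_left (sum_le_rearrangementSum hC n A hA) (norm_nonneg c)

theorem rearrangementSum_zero (n : ℕ) : rearrangementSum (0 : ℕ → 𝕜) n = 0 :=
  le_antisymm (rearrangementSum_le_of_forall _ n fun A _ => by simp) (rearrangementSum_nonneg _ n)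

end Rearrangement

/-- The underlying vector space of `d_*(w,1)`: the bounded sequences `x` with
`(x*(1) + ⋯ + x*(n)) / W(n) → 0`. -/
def lorentzPredualSubmodule (𝕜 : Type*) [RCLike 𝕜] (w : AdmissibleSeq) :
    Submodule 𝕜 (ℕ → 𝕜) where
  carrier := {x | (∃ C : ℝ, ∀ i, ‖x i‖ ≤ C) ∧
    Tendsto (fun n : ℕ => rearrangementSum x (n + 1) / w.W (n + 1)) atTop (𝓝 0)}
  zero_mem' := ⟨⟨0, by simp⟩, by simp [rearrangementSum_zero]⟩
  add_mem' := by
    rintro x y ⟨⟨C, hC⟩, hx⟩ ⟨⟨D, hD⟩, hy⟩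
    refine ⟨⟨C + D, fun i => (norm_add_le _ _).trans (add_le_add (hC i) (hD i))⟩, ?_⟩
    have h := hx.add hy
    rw [add_zero] at h
    refine squeeze_zero (fun n => div_nonneg (rearrangementSum_nonneg _ _) (w.W_pos n).le)
      (fun n => ?_) h
    rw [← add_div]
    exact div_le_div_of_nonneg_right (rearrangementSum_add_le hC hD _) (w.W_pos n).le
  smul_mem' := by
    rintro c x ⟨⟨C, hC⟩, hx⟩
    refine ⟨⟨‖c‖ * C, fun i => ?_⟩, ?_⟩
    · rw [Pi.smul_apply, norm_smul]
      exact mul_le_mul_of_nonneg_left (hC i) (norm_nonneg c)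
    have h := hx.const_mul ‖c‖
    rw [mul_zero] at h
    refine squeeze_zero (fun n => div_nonneg (rearrangementSum_nonneg _ _) (w.W_pos n).le)
      (fun n => ?_) h
    rw [← mul_div_assoc]
    exact div_le_div_of_nonneg_right (rearrangementSum_smul_le c hC _) (w.W_pos n).le

/-- The space `d_*(w,1)`, the predual of the Lorentz sequence space `d(w,1)`. This is a type
synonym, so that it carries the topology of its norm and not that of coordinatewise convergence. -/
def LorentzPredual (𝕜 : Type*) [RCLike 𝕜] (w : AdmissibleSeq) : Type _ :=
  lorentzPredualSubmodule 𝕜 w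

namespace LorentzPredual

variable {𝕜 : Type*} [RCLike 𝕜] {w : AdmissibleSeq}

instance : AddCommGroup (LorentzPredual 𝕜 w) :=
  inferInstanceAs (AddCommGroup (lorentzPredualSubmodule 𝕜 w))

instance : Module 𝕜 (LorentzPredual 𝕜 w) :=
  inferInstanceAs (Module 𝕜 (lorentzPredualSubmodule 𝕜 w))

/-- The sequence underlying an element of `d_*(w,1)`. -/
def toSeq (x : LorentzPredual 𝕜 w) : ℕ → 𝕜 := x.1

/-- `‖x‖_W = supₙ (x*(1) + ⋯ + x*(n)) / W(n)`, over `n ≥ 1`. -/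
noncomputable instance : Norm (LorentzPredual 𝕜 w) :=
  ⟨fun x => ⨆ n : ℕ, rearrangementSum x.toSeq (n + 1) / w.W (n + 1)⟩

theorem norm_def (x : LorentzPredual 𝕜 w) :
    ‖x‖ = ⨆ n : ℕ, rearrangementSum x.toSeq (n + 1) / w.W (n + 1) := rfl

theorem toSeq_add (x y : LorentzPredual 𝕜 w) : (x + y).toSeq = x.toSeq + y.toSeq := rfl

theorem toSeq_smul (c : 𝕜) (x : LorentzPredual 𝕜 w) : (c • x).toSeq = c • x.toSeq := rfl

theorem bounded_toSeq (x : LorentzPredual 𝕜 w) : ∃ C : ℝ, ∀ i, ‖x.toSeq i‖ ≤ C := x.2.1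

theorem rearrangementSum_div_le_norm (x : LorentzPredual 𝕜 w) (n : ℕ) :
    rearrangementSum x.toSeq (n + 1) / w.W (n + 1) ≤ ‖x‖ :=
  le_ciSup (f := fun n : ℕ => rearrangementSum x.toSeq (n + 1) / w.W (n + 1))
    x.2.2.bddAbove_range n

theorem norm_coord_le (x : LorentzPredual 𝕜 w) (i : ℕ) : ‖x.toSeq i‖ ≤ ‖x‖ := by
  obtain ⟨C, hC⟩ := x.bounded_toSeq
  have h := sum_le_rearrangementSum hC 1 {i} (by simp)
  have h1 := x.rearrangementSum_div_le_norm 0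
  simp only [AdmissibleSeq.W, zero_add, Finset.range_one, Finset.sum_singleton, w.first,
    div_one] at h h1
  exact h.trans h1

theorem norm_smul_le_aux (c : 𝕜) (x : LorentzPredual 𝕜 w) : ‖c • x‖ ≤ ‖c‖ * ‖x‖ := by
  obtain ⟨C, hC⟩ := x.bounded_toSeq
  refine ciSup_le fun n => ?_
  have h := div_le_div_of_nonneg_right (rearrangementSum_smul_le c hC (n + 1)) (w.W_pos n).le
  rw [mul_div_assoc] at h
  rw [toSeq_smul]
  exact h.trans (mul_le_mul_of_nonneg_left (x.rearrangementSum_div_le_norm n) (norm_nonneg c))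

noncomputable instance : NormedAddCommGroup (LorentzPredual 𝕜 w) :=
  AddGroupNorm.toNormedAddCommGroup
    { toFun := fun x => ‖x‖
      map_zero' := le_antisymm (by simpa using norm_smul_le_aux (0 : 𝕜) (0 : LorentzPredual 𝕜 w))
        ((norm_nonneg _).trans (norm_coord_le (0 : LorentzPredual 𝕜 w) 0))
      add_le' := fun x y => by
        obtain ⟨C, hC⟩ := x.bounded_toSeq
        obtain ⟨D, hD⟩ := y.bounded_toSeq
        refine ciSup_le fun n => ?_
        have h := div_le_div_of_nonneg_right (rearrangementSum_add_le hC hD (n + 1)) (w.W_pos n).le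
        rw [add_div] at h
        rw [toSeq_add]
        exact h.trans (add_le_add (x.rearrangementSum_div_le_norm n)
          (y.rearrangementSum_div_le_norm n))
      neg' := fun x => by
        have h : ∀ y : LorentzPredual 𝕜 w, ‖-y‖ ≤ ‖y‖ := fun y => by
          simpa using norm_smul_le_aux (-1 : 𝕜) y
        exact le_antisymm (h x) (by simpa using h (-x))
      eq_zero_of_map_eq_zero' := fun x hx => by
        refine Subtype.ext (funext fun i => ?_)
        have h := norm_coord_le x i
        rw [hx] at h
        exact norm_le_zero_iff.mp h }

noncomputable instance : NormedSpace 𝕜 (LorentzPredual 𝕜 w) where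
  norm_smul_le := norm_smul_le_aux

end LorentzPredual

section Polynomials

variable {𝕜 X : Type*} [RCLike 𝕜] [NormedAddCommGroup X] [NormedSpace 𝕜 X]

/-- A continuous `j`-homogeneous scalar-valued polynomial: `P x = Φ (x, …, x)` for some continuous
`j`-linear form `Φ` (a constant if `j = 0`). -/
def IsHomogeneousPoly (𝕜 : Type*) {X : Type*} [RCLike 𝕜] [NormedAddCommGroup X] [NormedSpace 𝕜 X]
    (j : ℕ) (P : X → 𝕜) : Prop :=
  ∃ Φ : ContinuousMultilinearMap 𝕜 (fun _ : Fin j => X) 𝕜, ∀ x, P x = Φ fun _ => x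

theorem IsHomogeneousPoly.add {j : ℕ} {P Q : X → 𝕜} (hP : IsHomogeneousPoly 𝕜 j P)
    (hQ : IsHomogeneousPoly 𝕜 j Q) : IsHomogeneousPoly 𝕜 j (P + Q) := by
  obtain ⟨Φ, hΦ⟩ := hP
  obtain ⟨Ψ, hΨ⟩ := hQ
  exact ⟨Φ + Ψ, fun x => by simp [hΦ, hΨ]⟩

theorem IsHomogeneousPoly.smul {j : ℕ} {P : X → 𝕜} (c : 𝕜) (hP : IsHomogeneousPoly 𝕜 j P) :
    IsHomogeneousPoly 𝕜 j (c • P) := by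
  obtain ⟨Φ, hΦ⟩ := hP
  exact ⟨c • Φ, fun x => by simp [hΦ]⟩

theorem IsHomogeneousPoly.map_smul {j : ℕ} {P : X → 𝕜} (hP : IsHomogeneousPoly 𝕜 j P) (c : 𝕜)
    (x : X) : P (c • x) = c ^ j * P x := by
  obtain ⟨Φ, hΦ⟩ := hP
  rw [hΦ, hΦ, Φ.map_smul_univ (fun _ => c) (fun _ => x)]
  simp

theorem IsHomogeneousPoly.bounded {j : ℕ} {P : X → 𝕜} (hP : IsHomogeneousPoly 𝕜 j P) :
    ∃ C : ℝ, ∀ x, ‖x‖ ≤ 1 → ‖P x‖ ≤ C := by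
  obtain ⟨Φ, hΦ⟩ := hP
  refine ⟨‖Φ‖, fun x hx => ?_⟩
  rw [hΦ]
  refine (Φ.le_opNorm _).trans (mul_le_of_le_one_right (norm_nonneg _) ?_)
  simpa using pow_le_one₀ (norm_nonneg x) hx

/-- The vector space of continuous scalar-valued polynomials `P = P₀ + ⋯ + P_N` on `X` of degree at
most `N`, where `P_j` is a continuous `j`-homogeneous polynomial. -/
def polySubmodule (𝕜 X : Type*) [RCLike 𝕜] [NormedAddCommGroup X] [NormedSpace 𝕜 X] (N : ℕ) :
    Submodule 𝕜 (X → 𝕜) where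
  carrier := {P | ∃ Q : ℕ → X → 𝕜, (∀ j, IsHomogeneousPoly 𝕜 j (Q j)) ∧
    P = ∑ j ∈ Finset.range (N + 1), Q j}
  zero_mem' := ⟨fun _ => 0, fun j => ⟨0, by simp⟩, by simp⟩
  add_mem' := by
    rintro P P' ⟨Q, hQ, rfl⟩ ⟨Q', hQ', rfl⟩
    exact ⟨fun j => Q j + Q' j, fun j => (hQ j).add (hQ' j), Finset.sum_add_distrib.symm⟩
  smul_mem' := by
    rintro c P ⟨Q, hQ, rfl⟩
    exact ⟨fun j => c • Q j, fun j => (hQ j).smul c, Finset.smul_sum⟩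

/-- The space `𝒫_N(X)` of continuous scalar-valued polynomials on `X` of degree at most `N`. This is
a type synonym, so that it carries the topology of the supremum norm over the unit ball. -/
def PolyDegLE (𝕜 X : Type*) [RCLike 𝕜] [NormedAddCommGroup X] [NormedSpace 𝕜 X] (N : ℕ) : Type _ :=
  polySubmodule 𝕜 X N

namespace PolyDegLE

variable {N : ℕ}

instance : AddCommGroup (PolyDegLE 𝕜 X N) := inferInstanceAs (AddCommGroup (polySubmodule 𝕜 X N))

instance : Module 𝕜 (PolyDegLE 𝕜 X N) := inferInstanceAs (Module 𝕜 (polySubmodule 𝕜 X N))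

instance : CoeFun (PolyDegLE 𝕜 X N) (fun _ => X → 𝕜) := ⟨fun P => P.1⟩

/-- The supremum norm `‖P‖ = sup {|P x| : ‖x‖ ≤ 1}`. -/
noncomputable instance : Norm (PolyDegLE 𝕜 X N) :=
  ⟨fun P => ⨆ x : Metric.closedBall (0 : X) 1, ‖P x‖⟩

theorem norm_def (P : PolyDegLE 𝕜 X N) : ‖P‖ = ⨆ x : Metric.closedBall (0 : X) 1, ‖P x‖ := rfl

theorem bounded (P : PolyDegLE 𝕜 X N) : ∃ C : ℝ, ∀ x, ‖x‖ ≤ 1 → ‖P x‖ ≤ C := by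
  obtain ⟨Q, hQ, hP⟩ := P.2
  choose C hC using fun j => (hQ j).bounded
  refine ⟨∑ j ∈ Finset.range (N + 1), C j, fun x hx => ?_⟩
  rw [hP, Finset.sum_apply]
  exact norm_sum_le_of_le _ fun j _ => hC j x hx

theorem norm_apply_le (P : PolyDegLE 𝕜 X N) {x : X} (hx : ‖x‖ ≤ 1) : ‖P x‖ ≤ ‖P‖ := by
  obtain ⟨C, hC⟩ := P.bounded
  refine le_ciSup (f := fun x : Metric.closedBall (0 : X) 1 => ‖P x‖) ⟨C, ?_⟩
    ⟨x, mem_closedBall_zero_iff.mpr hx⟩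
  rintro _ ⟨y, rfl⟩
  exact hC y (mem_closedBall_zero_iff.mp y.2)

theorem norm_le_of_forall (P : PolyDegLE 𝕜 X N) {r : ℝ} (h : ∀ x : X, ‖x‖ ≤ 1 → ‖P x‖ ≤ r) :
    ‖P‖ ≤ r := by
  have : Nonempty (Metric.closedBall (0 : X) 1) := ⟨⟨0, by simp⟩⟩
  exact ciSup_le fun x => h x (mem_closedBall_zero_iff.mp x.2)

theorem norm_smul_le_aux (c : 𝕜) (P : PolyDegLE 𝕜 X N) : ‖c • P‖ ≤ ‖c‖ * ‖P‖ := by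
  refine norm_le_of_forall _ fun x hx => ?_
  have h : (c • P) x = c * P x := rfl
  rw [h, norm_mul]
  exact mul_le_mul_of_nonneg_left (P.norm_apply_le hx) (norm_nonneg c)

theorem eq_zero_of_forall (P : PolyDegLE 𝕜 X N) (h : ∀ x : X, ‖x‖ ≤ 1 → P x = 0) : P = 0 := by
  obtain ⟨Q, hQ, hP⟩ := P.2
  refine Subtype.ext (funext fun x => ?_)
  let p : Polynomial 𝕜 := ∑ j ∈ Finset.range (N + 1), Polynomial.C (Q j x) * Polynomial.X ^ j
  have hp : ∀ t : 𝕜, p.eval t = P (t • x) := fun t => by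
    rw [hP, Finset.sum_apply, Polynomial.eval_finsetSum]
    refine Finset.sum_congr rfl fun j _ => ?_
    rw [(hQ j).map_smul]
    rw [Polynomial.eval_mul, Polynomial.eval_C, Polynomial.eval_pow, Polynomial.eval_X, mul_comm]
  have hr : (0 : ℝ) < 1 / (‖x‖ + 1) := by positivity
  have hp0 : p = 0 := by
    refine Polynomial.eq_zero_of_infinite_isRoot p
      (((infinite_of_mem_nhds (0 : 𝕜) (Metric.closedBall_mem_nhds _ hr))).mono fun t ht => ?_)
    change p.eval t = 0
    rw [hp]
    refine h _ ?_
    rw [norm_smul]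
    have ht' : ‖t‖ ≤ 1 / (‖x‖ + 1) := mem_closedBall_zero_iff.mp ht
    rw [le_div_iff₀ (by positivity)] at ht'
    nlinarith [norm_nonneg t]
  have h1 := hp 1
  rw [hp0, one_smul, Polynomial.eval_zero] at h1
  exact h1.symm

noncomputable instance : NormedAddCommGroup (PolyDegLE 𝕜 X N) :=
  AddGroupNorm.toNormedAddCommGroup
    { toFun := fun P => ‖P‖
      map_zero' := le_antisymm (by simpa using norm_smul_le_aux (0 : 𝕜) (0 : PolyDegLE 𝕜 X N))
        ((norm_nonneg _).trans (norm_apply_le (0 : PolyDegLE 𝕜 X N) (x := 0) (by simp)))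
      add_le' := fun P Q => norm_le_of_forall _ fun _ hx =>
        (norm_add_le _ _).trans (add_le_add (P.norm_apply_le hx) (Q.norm_apply_le hx))
      neg' := fun P => by
        have h : ∀ Q : PolyDegLE 𝕜 X N, ‖-Q‖ ≤ ‖Q‖ := fun Q => by
          simpa using norm_smul_le_aux (-1 : 𝕜) Q
        exact le_antisymm (h P) (by simpa using h (-P))
      eq_zero_of_map_eq_zero' := fun P hP => P.eq_zero_of_forall fun x hx => by
        have h := P.norm_apply_le hx
        rw [hP] at h
        exact norm_le_zero_iff.mp h }

noncomputable instance : NormedSpace 𝕜 (PolyDegLE 𝕜 X N) where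
  norm_smul_le := norm_smul_le_aux

/-- `P` attains its norm: `|P x₀| = ‖P‖` for some `x₀` in the closed unit ball. -/
def NormAttaining (P : PolyDegLE 𝕜 X N) : Prop := ∃ x₀ : X, ‖x₀‖ ≤ 1 ∧ ‖P x₀‖ = ‖P‖

end PolyDegLE

end Polynomials

/-! Everything rests on one phenomenon: if `w ∉ ℓ_m`, a bounded `m`-linear form is negligible far
out. Suppose it stays above `ε` on tuples of disjointly supported sparse vectors `x_1, x_2, …` of
the unit ball. Sparse disjoint vectors can be summed with coefficients `w_Q, w_{2Q}, …` without
leaving the ball, and averaging over signs isolates the diagonal of the form, so `∑ w_{kQ}^m` is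
bounded and `w ∈ ℓ_m`. General vectors split at a height `η` into a sparse part and a part of small
sup norm. Flat vectors need no weight: if the heights decrease fast enough, even the sum of their
absolute values has norm at most 2. This is `exists_norm_le_of_sparse_of_flat`, which leads to
`exists_norm_le_of_tail`.

If `w ∉ ℓ_N`, then `w ∉ ℓ_j` for all `j ≤ N`, so every polynomial of degree at most `N` is
approximated, uniformly on the ball, by its compositions with the projections to finitely many
coordinates. These attain their norms by compactness (`dense_normAttaining`).

If `w ∈ ℓ_N`, let `M = m + 1` be the least exponent with `w ∈ ℓ_M`. By majorization `R x = 1 + ∑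
x(k)^M` is a bounded polynomial, with norm at least `1 + ∑ w_i^M`. Let `P` be close to `R` and
attain its norm at `x`. The ball is flat at `x`: for one `δ > 0` it contains `x + δ e_k` for all
large `k`. This move adds about `δ^M` to `R`. In `P - R`, the terms of degree `1, …, m` in `δ`
vanish as `k → ∞`, by the phenomenon above, and the higher ones are at most a small multiple of
`δ^M`. Maximality of `|P x|` then makes the real part of `P x` small (`re_le_of_normAttaining`),
whereas the summand 1 in `R` forces it to be at least 3/4 (`not_dense_normAttaining`). -/

namespace AdmissibleSeq

/-! ### Elementary properties of the weights. -/

variable (w : AdmissibleSeq)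

theorem W_zero : w.W 0 = 0 := by simp [W]

theorem W_one : w.W 1 = 1 := by simp [W, w.first]

theorem W_succ (n : ℕ) : w.W (n + 1) = w.W n + w.seq n := Finset.sum_range_succ _ _

theorem W_mono : Monotone w.W :=
  monotone_nat_of_le_succ fun n => by rw [W_succ]; linarith [w.nonneg n]

theorem W_nonneg (n : ℕ) : 0 ≤ w.W n := Finset.sum_nonneg fun i _ => w.nonneg i

theorem one_le_W {n : ℕ} (hn : 1 ≤ n) : 1 ≤ w.W n := w.W_one ▸ w.W_mono hn

theorem seq_le_one (n : ℕ) : w.seq n ≤ 1 := w.first ▸ w.antitone (Nat.zero_le n)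

theorem seq_pos (n : ℕ) : 0 < w.seq n := by
  refine lt_of_le_of_ne (w.nonneg n) fun h => w.not_summable ?_
  refine summable_of_ne_finset_zero (s := Finset.range n) fun i hi => ?_
  have h1 : n ≤ i := by simpa using hi
  exact le_antisymm (h ▸ w.antitone h1) (w.nonneg i)

theorem tendsto_W : Tendsto w.W atTop atTop :=
  (not_summable_iff_tendsto_nat_atTop_of_nonneg w.nonneg).1 w.not_summable

theorem tendsto_W_div : Tendsto (fun n : ℕ => (n : ℝ)⁻¹ * w.W n) atTop (𝓝 0) :=
  w.tendsto_zero.cesaro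

/-- Each of the `p` weights that separate `W q` from `W (q + p)` has index below `m`, hence is at
least `w.seq m`. -/
theorem mul_seq_le_W_sub (q p m : ℕ) (h : q + p ≤ m) : p * w.seq m + w.W q ≤ w.W (q + p) := by
  induction p with
  | zero => simp
  | succ p ih =>
    have h1 := ih (by omega)
    have h2 : w.seq m ≤ w.seq (q + p) := w.antitone (by omega)
    rw [← add_assoc, W_succ]
    push_cast
    linarith

end AdmissibleSeq

/-! ### Norm, order structure and unit vectors of `d_*(w,1)`. -/

namespace LorentzPredual

variable {𝕜 : Type*} [RCLike 𝕜] {w : AdmissibleSeq}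

/-- Together with `norm_le_of_sum_le`, this replaces rearrangements by sums over arbitrary finite
sets; most later norm estimates are made in this form. -/
theorem sum_norm_le (x : LorentzPredual 𝕜 w) (A : Finset ℕ) :
    ∑ i ∈ A, ‖x.toSeq i‖ ≤ ‖x‖ * w.W A.card := by
  rcases A.eq_empty_or_nonempty with rfl | hA
  · simp [AdmissibleSeq.W_zero]
  obtain ⟨n, hn⟩ : ∃ n, A.card = n + 1 := Nat.exists_eq_add_one.2 hA.card_pos
  obtain ⟨C, hC⟩ := x.bounded_toSeq
  rw [hn, ← div_le_iff₀ (w.W_pos n)]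
  refine le_trans ?_ (x.rearrangementSum_div_le_norm n)
  exact div_le_div_of_nonneg_right (sum_le_rearrangementSum hC _ A hn) (w.W_pos n).le

theorem norm_le_of_sum_le {x : LorentzPredual 𝕜 w} {r : ℝ}
    (h : ∀ A : Finset ℕ, A.Nonempty → ∑ i ∈ A, ‖x.toSeq i‖ ≤ r * w.W A.card) : ‖x‖ ≤ r := by
  refine ciSup_le fun n => ?_
  rw [div_le_iff₀ (w.W_pos n)]
  refine rearrangementSum_le_of_forall _ _ fun A hA => hA ▸ h A ?_
  exact Finset.card_pos.1 (by omega)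

theorem exists_sum_le_mul_W (x : LorentzPredual 𝕜 w) {ε : ℝ} (hε : 0 < ε) :
    ∃ n, ∀ A : Finset ℕ, n ≤ A.card → ∑ i ∈ A, ‖x.toSeq i‖ ≤ ε * w.W A.card := by
  obtain ⟨C, hC⟩ := x.bounded_toSeq
  obtain ⟨n, hn⟩ := eventually_atTop.1 (x.2.2.eventually_le_const hε)
  refine ⟨n + 1, fun A hA => ?_⟩
  obtain ⟨m, hm⟩ : ∃ m, A.card = m + 1 := Nat.exists_eq_add_one.2 (by omega)
  have h := hn m (by omega)
  rw [div_le_iff₀ (w.W_pos m)] at h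
  rw [hm]
  exact (sum_le_rearrangementSum hC _ A hm).trans h

theorem mem_of_exists_sum_le {y : ℕ → 𝕜} (hb : ∃ C : ℝ, ∀ i, ‖y i‖ ≤ C)
    (h : ∀ ε : ℝ, 0 < ε →
      ∃ n, ∀ A : Finset ℕ, n ≤ A.card → ∑ i ∈ A, ‖y i‖ ≤ ε * w.W A.card) :
    y ∈ lorentzPredualSubmodule 𝕜 w := by
  refine ⟨hb, ?_⟩
  rw [Metric.tendsto_atTop]
  intro ε hε
  obtain ⟨n, hn⟩ := h (ε / 2) (by positivity)
  refine ⟨n, fun m hm => ?_⟩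
  have h1 : rearrangementSum y (m + 1) / w.W (m + 1) ≤ ε / 2 := by
    rw [div_le_iff₀ (w.W_pos m)]
    refine rearrangementSum_le_of_forall _ _ fun A hA => ?_
    rw [← hA]
    exact hn A (by omega)
  rw [Real.dist_eq, sub_zero,
    abs_of_nonneg (div_nonneg (rearrangementSum_nonneg _ _) (w.W_pos m).le)]
  linarith

@[ext]
theorem ext {x y : LorentzPredual 𝕜 w} (h : ∀ i, x.toSeq i = y.toSeq i) : x = y :=
  Subtype.ext (funext h)

/-- The element of `d_*(w,1)` given by a sequence which some element of `d_*(w,1)` dominates. -/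
def ofDominated (x : LorentzPredual 𝕜 w) (y : ℕ → 𝕜) (h : ∀ i, ‖y i‖ ≤ ‖x.toSeq i‖) :
    LorentzPredual 𝕜 w :=
  ⟨y, mem_of_exists_sum_le ⟨‖x‖, fun i => (h i).trans (x.norm_coord_le i)⟩ fun _ hε =>
    (x.exists_sum_le_mul_W hε).imp fun _ hn A hA =>
      (Finset.sum_le_sum fun i _ => h i).trans (hn A hA)⟩

@[simp]
theorem toSeq_ofDominated (x : LorentzPredual 𝕜 w) (y : ℕ → 𝕜) (h : ∀ i, ‖y i‖ ≤ ‖x.toSeq i‖) :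
    (ofDominated x y h).toSeq = y := rfl

theorem norm_le_norm_of_coord {x y : LorentzPredual 𝕜 w} (h : ∀ i, ‖x.toSeq i‖ ≤ ‖y.toSeq i‖) :
    ‖x‖ ≤ ‖y‖ :=
  norm_le_of_sum_le fun A _ => (Finset.sum_le_sum fun i _ => h i).trans (y.sum_norm_le A)

/-- The `i`-th coordinate as a linear form. -/
def coord (i : ℕ) : LorentzPredual 𝕜 w →ₗ[𝕜] 𝕜 where
  toFun x := x.toSeq i
  map_add' _ _ := rfl
  map_smul' _ _ := rfl

theorem toSeq_sum {κ : Type*} (s : Finset κ) (f : κ → LorentzPredual 𝕜 w) (i : ℕ) :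
    (∑ k ∈ s, f k).toSeq i = ∑ k ∈ s, (f k).toSeq i :=
  map_sum (coord i : LorentzPredual 𝕜 w →ₗ[𝕜] 𝕜) f s

@[simp]
theorem toSeq_add_apply (x y : LorentzPredual 𝕜 w) (i : ℕ) :
    (x + y).toSeq i = x.toSeq i + y.toSeq i := rfl

@[simp]
theorem toSeq_smul_apply (c : 𝕜) (x : LorentzPredual 𝕜 w) (i : ℕ) :
    (c • x).toSeq i = c * x.toSeq i := rfl

@[simp]
theorem toSeq_zero_apply (i : ℕ) : (0 : LorentzPredual 𝕜 w).toSeq i = 0 := rfl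

/-- The restriction of a sequence to a set of coordinates. -/
noncomputable def mask (S : Set ℕ) : LorentzPredual 𝕜 w →ₗ[𝕜] LorentzPredual 𝕜 w where
  toFun x := ofDominated x (S.indicator x.toSeq) fun i => by
    by_cases h : i ∈ S <;> simp [h]
  map_add' x y := by
    ext i
    by_cases h : i ∈ S <;> simp [h]
  map_smul' c x := by
    ext i
    by_cases h : i ∈ S <;> simp [h]

theorem toSeq_mask (S : Set ℕ) (x : LorentzPredual 𝕜 w) :
    (mask S x).toSeq = S.indicator x.toSeq := rfl

theorem toSeq_mask_of_mem {S : Set ℕ} {i : ℕ} (h : i ∈ S) (x : LorentzPredual 𝕜 w) :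
    (mask S x).toSeq i = x.toSeq i := by simp [toSeq_mask, h]

theorem toSeq_mask_of_notMem {S : Set ℕ} {i : ℕ} (h : i ∉ S) (x : LorentzPredual 𝕜 w) :
    (mask S x).toSeq i = 0 := by simp [toSeq_mask, h]

theorem norm_toSeq_mask_le (S : Set ℕ) (x : LorentzPredual 𝕜 w) (i : ℕ) :
    ‖(mask S x).toSeq i‖ ≤ ‖x.toSeq i‖ := by
  by_cases h : i ∈ S <;> simp [toSeq_mask, h]

theorem norm_mask_le (S : Set ℕ) (x : LorentzPredual 𝕜 w) : ‖mask S x‖ ≤ ‖x‖ :=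
  norm_le_norm_of_coord (norm_toSeq_mask_le S x)

theorem mask_add_mask_compl (S : Set ℕ) (x : LorentzPredual 𝕜 w) :
    mask S x + mask Sᶜ x = x := by
  ext i
  by_cases h : i ∈ S <;> simp [toSeq_mask, h]

/-- The sequence of absolute values. -/
def absVal (x : LorentzPredual 𝕜 w) : LorentzPredual 𝕜 w :=
  ofDominated x (fun i => (‖x.toSeq i‖ : 𝕜)) fun i => by simp

@[simp]
theorem toSeq_absVal (x : LorentzPredual 𝕜 w) (i : ℕ) :
    (absVal x).toSeq i = (‖x.toSeq i‖ : 𝕜) := rfl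

theorem norm_absVal (x : LorentzPredual 𝕜 w) : ‖absVal x‖ = ‖x‖ :=
  le_antisymm (norm_le_norm_of_coord fun i => by simp) (norm_le_norm_of_coord fun i => by simp)

/-- The `k`-th unit vector. -/
noncomputable def unitVec (k : ℕ) : LorentzPredual 𝕜 w :=
  ⟨Pi.single k 1, by
    have hs : ∀ A : Finset ℕ, ∑ i ∈ A, ‖(Pi.single k 1 : ℕ → 𝕜) i‖ ≤ 1 := fun A => by
      have : ∀ i ∈ A, ‖(Pi.single k 1 : ℕ → 𝕜) i‖ = if i = k then 1 else 0 := fun i _ => by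
        by_cases h : i = k <;> simp [h]
      rw [Finset.sum_congr rfl this, Finset.sum_ite_eq']
      split_ifs <;> norm_num
    refine mem_of_exists_sum_le ⟨1, fun i => by simpa using hs {i}⟩ fun ε hε => ?_
    obtain ⟨n, hn⟩ := eventually_atTop.1 (w.tendsto_W.eventually_ge_atTop (1 / ε))
    refine ⟨n, fun A hA => (hs A).trans ?_⟩
    have := hn _ hA
    rwa [div_le_iff₀' hε] at this⟩

theorem toSeq_unitVec (k i : ℕ) :
    (unitVec k : LorentzPredual 𝕜 w).toSeq i = if i = k then 1 else 0 := by
  change (Pi.single k 1 : ℕ → 𝕜) i = _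
  simp [Pi.single_apply]

theorem sum_norm_unitVec (k : ℕ) (A : Finset ℕ) :
    ∑ i ∈ A, ‖(unitVec k : LorentzPredual 𝕜 w).toSeq i‖ = if k ∈ A then 1 else 0 := by
  rw [← Finset.sum_ite_eq' A k fun _ => (1 : ℝ)]
  refine Finset.sum_congr rfl fun i _ => ?_
  rw [toSeq_unitVec]
  split_ifs <;> simp

theorem norm_unitVec_le (k : ℕ) : ‖(unitVec k : LorentzPredual 𝕜 w)‖ ≤ 1 := by
  refine norm_le_of_sum_le fun A hA => ?_
  rw [sum_norm_unitVec, one_mul]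
  have := w.one_le_W hA.card_pos
  split_ifs <;> linarith

theorem mask_Iio_eq_sum (n : ℕ) (x : LorentzPredual 𝕜 w) :
    mask (Set.Iio n) x = ∑ k ∈ Finset.range n, x.toSeq k • unitVec k := by
  ext i
  rw [toSeq_sum]
  simp only [toSeq_smul_apply, toSeq_unitVec, mul_ite, mul_one, mul_zero, Finset.sum_ite_eq,
    Finset.mem_range, toSeq_mask, Set.indicator_apply, Set.mem_Iio]

/-- In the unit ball, the number of coordinates of modulus `> η` is uniformly bounded. -/
theorem exists_card_large_coord_le (𝕜 : Type*) [RCLike 𝕜] (w : AdmissibleSeq) {η : ℝ}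
    (hη : 0 < η) : ∃ Q : ℕ, ∀ x : LorentzPredual 𝕜 w, ‖x‖ ≤ 1 →
      {i | η < ‖x.toSeq i‖}.encard ≤ Q := by
  -- The means `W(n)/n` tend to zero, so from some point on `n + 1` coordinates above `η` would have
  -- a sum exceeding `W(n + 1)`.
  obtain ⟨n, hn⟩ := eventually_atTop.1 (w.tendsto_W_div.eventually_lt_const hη)
  refine ⟨n, fun x hx => ?_⟩
  by_contra! hlt
  obtain ⟨t, hts, htc⟩ := Set.exists_subset_encard_eq (Order.add_one_le_of_lt hlt)
  have hfin : t.Finite := Set.finite_of_encard_eq_coe (k := n + 1) (by rw [htc]; norm_cast)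
  lift t to Finset ℕ using hfin
  have hc : t.card = n + 1 := by
    rw [Set.encard_coe_eq_coe_finsetCard] at htc
    exact_mod_cast htc
  have h1 := x.sum_norm_le t
  have h2 : t.card • η ≤ ∑ i ∈ t, ‖x.toSeq i‖ :=
    Finset.card_nsmul_le_sum _ _ _ fun i hi => (hts hi).le
  have h3 := hn (n + 1) (by omega)
  rw [hc] at h1 h2
  have h4 : (0 : ℝ) < ((n + 1 : ℕ) : ℝ) := by positivity
  rw [inv_mul_lt_iff₀ h4] at h3
  rw [nsmul_eq_mul] at h2
  have h5 := mul_le_mul_of_nonneg_right hx (w.W_nonneg (n + 1))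
  linarith

theorem tendsto_coord (x : LorentzPredual 𝕜 w) : Tendsto x.toSeq atTop (𝓝 0) := by
  rw [← Nat.cofinite_eq_atTop, NormedAddGroup.tendsto_nhds_zero]
  intro ε hε
  obtain ⟨Q, hQ⟩ := exists_card_large_coord_le 𝕜 w (η := ε / 2 / (‖x‖ + 1)) (by positivity)
  have hp : 0 < ‖x‖ + 1 := by positivity
  have h := hQ (((‖x‖ + 1 : ℝ)⁻¹ : 𝕜) • x) (by
    rw [norm_smul, norm_inv, RCLike.norm_ofReal, abs_of_pos hp, inv_mul_le_iff₀ hp]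
    linarith)
  have hfin := Set.finite_of_encard_le_coe h
  rw [eventually_cofinite]
  refine hfin.subset fun i hi => ?_
  have hi' : ε ≤ ‖x.toSeq i‖ := not_lt.1 hi
  rw [Set.mem_ofPred_eq, toSeq_smul_apply, norm_mul, norm_inv, RCLike.norm_ofReal, abs_of_pos hp,
    div_eq_inv_mul]
  exact mul_lt_mul_of_pos_left (by linarith) (by positivity)

/-- Near a point of the unit ball, the unit ball is flat in the direction of all but finitely many
unit vectors. -/
theorem exists_norm_add_smul_unitVec_le {x : LorentzPredual 𝕜 w} (hx : ‖x‖ ≤ 1) :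
    ∃ δ : ℝ, 0 < δ ∧ δ ≤ 1 ∧ ∀ᶠ k in atTop, ‖x + (δ : 𝕜) • unitVec k‖ ≤ 1 := by
  obtain ⟨n, hn⟩ := x.exists_sum_le_mul_W (ε := 1 / 2) (by norm_num)
  have hpos := w.seq_pos n
  -- Sets with at least `n` elements leave room `W/2 ≥ 1/2`. On a smaller set containing `k`, both
  -- `x(k)` and the added `δ` are at most `w.seq n / 2`, and together they fit into the one weight
  -- that index `k` contributes.
  refine ⟨w.seq n / 2, by positivity, by linarith [w.seq_le_one n], ?_⟩
  filter_upwards [x.tendsto_coord.norm.eventually_le_const (u := w.seq n / 2)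
    (by rw [norm_zero]; positivity)] with k hk
  have hδ : ‖((w.seq n / 2 : ℝ) : 𝕜)‖ = w.seq n / 2 := by
    rw [RCLike.norm_ofReal, abs_of_pos (by positivity)]
  refine norm_le_of_sum_le fun A hA => ?_
  have hsum : ∑ i ∈ A, ‖(x + ((w.seq n / 2 : ℝ) : 𝕜) • unitVec k).toSeq i‖ ≤
      ∑ i ∈ A, ‖x.toSeq i‖ + w.seq n / 2 * if k ∈ A then 1 else 0 := by
    rw [← sum_norm_unitVec (𝕜 := 𝕜) (w := w) k A, Finset.mul_sum, ← Finset.sum_add_distrib]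
    refine Finset.sum_le_sum fun i _ => ?_
    rw [toSeq_add_apply, toSeq_smul_apply]
    refine (norm_add_le _ _).trans ?_
    rw [norm_mul, hδ]
  refine hsum.trans ?_
  rw [one_mul]
  have hball : ∀ B : Finset ℕ, ∑ i ∈ B, ‖x.toSeq i‖ ≤ w.W B.card := fun B =>
    (x.sum_norm_le B).trans (mul_le_of_le_one_left (w.W_nonneg _) hx)
  split_ifs with hkA
  · rcases le_or_gt n A.card with hle | hlt
    · linarith [hn A hle, w.one_le_W hA.card_pos, w.seq_le_one n]
    · have h1 := Finset.add_sum_erase A (fun i => ‖x.toSeq i‖) hkA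
      have h2 := hball (A.erase k)
      have h3 := w.W_succ (A.erase k).card
      rw [Finset.card_erase_add_one hkA] at h3
      have h4 : w.seq n ≤ w.seq (A.erase k).card :=
        w.antitone (by have := Finset.card_erase_add_one hkA; omega)
      linarith
  · linarith [hball A]

/-- Adding a sequence of small sup norm hardly increases the norm. -/
theorem exists_norm_add_le (x : LorentzPredual 𝕜 w) {B δ : ℝ} (hx : ‖x‖ ≤ B) (hB : 1 ≤ B)
    (hδ : 0 < δ) : ∃ η : ℝ, 0 < η ∧ ∀ z : LorentzPredual 𝕜 w, ‖z‖ ≤ 1 →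
      (∀ i, ‖z.toSeq i‖ ≤ η) → ‖x + z‖ ≤ B + δ := by
  obtain ⟨n, hn⟩ := x.exists_sum_le_mul_W hδ
  -- On large sets `x` uses only `δ W`, leaving `z` its full share `W`; on sets with fewer than `n`
  -- elements the flat `z` adds at most `δ`.
  refine ⟨δ / (n + 1), by positivity, fun z hz hzη => norm_le_of_sum_le fun A hA => ?_⟩
  have hsum : ∑ i ∈ A, ‖(x + z).toSeq i‖ ≤ ∑ i ∈ A, ‖x.toSeq i‖ + ∑ i ∈ A, ‖z.toSeq i‖ := by
    rw [← Finset.sum_add_distrib]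
    exact Finset.sum_le_sum fun i _ => norm_add_le _ _
  refine hsum.trans ?_
  rw [add_mul]
  have hW := w.one_le_W hA.card_pos
  rcases le_or_gt n A.card with hle | hlt
  · have h1 := z.sum_norm_le A
    have h2 := mul_le_mul_of_nonneg_right (hz.trans hB) (w.W_nonneg A.card)
    linarith [hn A hle]
  · have h1 := x.sum_norm_le A
    have h2 := mul_le_mul_of_nonneg_right hx (w.W_nonneg A.card)
    have h3 : ∑ i ∈ A, ‖z.toSeq i‖ ≤ A.card • (δ / (n + 1)) :=
      Finset.sum_le_card_nsmul _ _ _ fun i _ => hzη i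
    have h4 : A.card • (δ / (n + 1)) ≤ δ := by
      rw [nsmul_eq_mul, mul_div_assoc', div_le_iff₀ (by positivity), mul_comm]
      refine mul_le_mul_of_nonneg_left ?_ hδ.le
      exact_mod_cast (by omega : A.card ≤ n + 1)
    have h5 : δ ≤ δ * w.W A.card := le_mul_of_one_le_right hδ.le hW
    linarith

end LorentzPredual

/-! ### Sign averages and diagonals of multilinear forms. -/

section DiagonalAveraging

/-- Orthogonality of the coordinate signs: for `a ≠ b`, flipping the sign at `a` pairs off the
summands. -/
theorem sum_signs_mul {κ : Type*} [Fintype κ] [DecidableEq κ] (R : Type*) [CommRing R] (a b : κ) :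
    ∑ σ : κ → ℤˣ, (((σ a : ℤ) : R) * ((σ b : ℤ) : R)) =
      if a = b then (Fintype.card (κ → ℤˣ) : R) else 0 := by
  split_ifs with h
  · subst h
    have : ∀ σ : κ → ℤˣ, (((σ a : ℤ) : R) * ((σ a : ℤ) : R)) = 1 := fun σ => by
      rcases Int.units_eq_one_or (σ a) with h | h <;> simp [h]
    simp [this]
  · refine Finset.sum_involution (fun σ _ => Function.update σ a (-σ a)) ?_ ?_ ?_ ?_
    · intro σ _
      simp [Function.update_of_ne (Ne.symm h)]
    · intro σ _ _ heq
      have := congrFun heq a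
      rw [Function.update_self] at this
      rcases Int.units_eq_one_or (σ a) with h | h <;> simp [h] at this
    · simp
    · intro σ _
      simp

variable {𝕜 V ι κ : Type*} [RCLike 𝕜] [AddCommGroup V] [Module 𝕜 V] [Fintype ι] [DecidableEq ι]
  [Fintype κ]

theorem MultilinearMap.map_sum_smul (Φ : MultilinearMap 𝕜 (fun _ : ι => V) 𝕜) (c : ι → κ → 𝕜)
    (y : ι → κ → V) : (Φ fun i => ∑ k, c i k • y i k) =
      ∑ r : ι → κ, (∏ i, c i (r i)) * Φ fun i => y i (r i) := by
  rw [Φ.map_sum]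
  exact Finset.sum_congr rfl fun r _ => Φ.map_smul_univ _ _

theorem exists_unimodular_mul_eq_norm (z : 𝕜) : ∃ θ : 𝕜, ‖θ‖ = 1 ∧ θ * z = (‖z‖ : 𝕜) := by
  rcases eq_or_ne z 0 with rfl | hz
  · exact ⟨1, by simp⟩
  · have hn : (‖z‖ : 𝕜) ≠ 0 := by simpa using hz
    refine ⟨(‖z‖ : 𝕜) / z, ?_, div_mul_cancel₀ _ hz⟩
    rw [norm_div, RCLike.norm_ofReal, abs_norm, div_self (norm_ne_zero_iff.2 hz)]

/-- The diagonal of a multilinear form is controlled by the form itself. -/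
theorem MultilinearMap.sum_norm_diag_le [DecidableEq κ] [Nonempty ι]
    (Φ : MultilinearMap 𝕜 (fun _ : ι => V) 𝕜)
    (y : ι → κ → V) {C : ℝ}
    (hC : ∀ c : ι → κ → 𝕜, (∀ i k, ‖c i k‖ ≤ 1) → ‖Φ fun i => ∑ k, c i k • y i k‖ ≤ C) :
    ∑ k, ‖Φ fun i => y i k‖ ≤ C := by
  obtain ⟨i₀⟩ := ‹Nonempty ι›
  choose θ hθ hθz using fun k => exists_unimodular_mul_eq_norm (Φ fun i => y i k)
  set T : ℕ := Fintype.card (κ → ℤˣ) with hT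
  -- Independent signs in all slots but `i₀`, and their product in slot `i₀`: a multi-index `r`
  -- survives averaging only if all its entries equal `r i₀`. The phase `θ` turns diagonal values
  -- into absolute values. The signs `s i₀` are not used and only contribute one more factor `T`.
  let c : (ι → κ → ℤˣ) → ι → κ → 𝕜 := fun s i k =>
    if i = i₀ then θ k * ∏ j ∈ Finset.univ.erase i₀, ((s j k : ℤ) : 𝕜) else ((s i k : ℤ) : 𝕜)
  have hsign : ∀ u : ℤˣ, ‖((u : ℤ) : 𝕜)‖ = 1 := fun u => by
    rcases Int.units_eq_one_or u with h | h <;> simp [h]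
  have hc : ∀ s i k, ‖c s i k‖ ≤ 1 := fun s i k => by
    simp only [c]
    split_ifs
    · rw [norm_mul, hθ, norm_prod, one_mul]
      exact (Finset.prod_congr rfl fun j _ => hsign _).trans_le (by simp)
    · exact (hsign _).le
  have hprod : ∀ (s : ι → κ → ℤˣ) (r : ι → κ), ∏ i, c s i (r i) =
      θ (r i₀) * ∏ i, (((s i (r i) : ℤ) : 𝕜) * ((s i (r i₀) : ℤ) : 𝕜)) := fun s r => by
    rw [← Finset.mul_prod_erase _ _ (Finset.mem_univ i₀),
      ← Finset.mul_prod_erase Finset.univ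
        (fun i => ((s i (r i) : ℤ) : 𝕜) * ((s i (r i₀) : ℤ) : 𝕜)) (Finset.mem_univ i₀)]
    have h1 : ((s i₀ (r i₀) : ℤ) : 𝕜) * ((s i₀ (r i₀) : ℤ) : 𝕜) = 1 := by
      rcases Int.units_eq_one_or (s i₀ (r i₀)) with h | h <;> simp [h]
    rw [h1, one_mul, Finset.prod_mul_distrib]
    have h2 : ∏ x ∈ Finset.univ.erase i₀, c s x (r x) =
        ∏ x ∈ Finset.univ.erase i₀, ((s x (r x) : ℤ) : 𝕜) :=
      Finset.prod_congr rfl fun i hi => if_neg (Finset.ne_of_mem_erase hi)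
    rw [h2]
    simp only [c, if_true]
    ring
  have hind : ∀ r : ι → κ, ∏ i, (if r i = r i₀ then (T : 𝕜) else 0) =
      (T : 𝕜) ^ Fintype.card ι * ∑ k, if r = fun _ => k then 1 else 0 := fun r => by
    by_cases hr : ∀ i, r i = r i₀
    · have h1 : ∀ k, (r = fun _ => k) ↔ r i₀ = k :=
        fun k => ⟨fun h => by rw [h], fun h => funext fun i => (hr i).trans h⟩
      simp [h1, hr]
    · push Not at hr
      obtain ⟨i, hi⟩ := hr
      have h1 : ∀ k, ¬ (r = fun _ => k) := fun k h => hi (by rw [h])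
      rw [Finset.prod_eq_zero (Finset.mem_univ i) (if_neg hi)]
      simp [h1]
  have key : ∑ s : ι → κ → ℤˣ, Φ (fun i => ∑ k, c s i k • y i k) =
      (T : 𝕜) ^ Fintype.card ι * ∑ k, (‖Φ fun i => y i k‖ : 𝕜) := by
    simp_rw [Φ.map_sum_smul]
    rw [Finset.sum_comm]
    have h1 : ∀ r : ι → κ, ∑ s : ι → κ → ℤˣ, (∏ i, c s i (r i)) * Φ (fun i => y i (r i)) =
        ∑ k, if r = fun _ => k then
          (T : 𝕜) ^ Fintype.card ι * (‖Φ fun i => y i k‖ : 𝕜) else 0 := fun r => by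
      simp_rw [hprod]
      rw [← Finset.sum_mul, ← Finset.mul_sum]
      have h2 := Finset.prod_univ_sum (fun _ : ι => (Finset.univ : Finset (κ → ℤˣ)))
        (fun i σ => ((σ (r i) : ℤ) : 𝕜) * ((σ (r i₀) : ℤ) : 𝕜))
      rw [Fintype.piFinset_univ] at h2
      rw [← h2]
      simp_rw [sum_signs_mul]
      rw [hind, Finset.mul_sum, Finset.mul_sum, Finset.sum_mul]
      refine Finset.sum_congr rfl fun k _ => ?_
      split_ifs with h
      · rw [← hθz, h]
        ring
      · ring
    rw [Finset.sum_congr rfl fun r _ => h1 r, Finset.sum_comm, Finset.mul_sum]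
    simp
  have hTpos : (0 : ℝ) < (T : ℝ) ^ Fintype.card ι := by
    have : 0 < T := Fintype.card_pos
    positivity
  have hle : ‖∑ s : ι → κ → ℤˣ, Φ (fun i => ∑ k, c s i k • y i k)‖ ≤
      (T : ℝ) ^ Fintype.card ι * C := by
    refine (norm_sum_le_of_le _ fun s _ => hC (c s) (hc s)).trans_eq ?_
    simp [hT]
  rw [key, norm_mul, norm_pow, RCLike.norm_natCast] at hle
  refine le_of_mul_le_mul_left (le_trans (le_of_eq ?_) hle) hTpos
  rw [← RCLike.ofReal_sum, RCLike.norm_ofReal,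
    abs_of_nonneg (Finset.sum_nonneg fun _ _ => norm_nonneg _)]

end DiagonalAveraging

/-! ### Weighted sums of disjoint sparse vectors, and sampling the weights. -/

namespace LorentzPredual

variable {𝕜 : Type*} [RCLike 𝕜] {w : AdmissibleSeq}

/-- Disjointly supported elements of the unit ball with at most `Q` nonzero coordinates each may be
combined with the weights `w_Q, w_{2Q}, …`. -/
theorem norm_sum_smul_le_of_disjoint (Q : ℕ) (x : ℕ → LorentzPredual 𝕜 w) (T : ℕ → Finset ℕ)
    (c : ℕ → 𝕜) (K : ℕ) (hx : ∀ k < K, ‖x k‖ ≤ 1) (hT : ∀ k < K, (T k).card ≤ Q)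
    (hxT : ∀ k < K, ∀ i ∉ T k, (x k).toSeq i = 0)
    (hd : ∀ k < K, ∀ j < k, Disjoint (T j) (T k))
    (hc : ∀ k < K, ‖c k‖ ≤ w.seq ((k + 1) * Q)) :
    ‖∑ k ∈ Finset.range K, c k • x k‖ ≤ 1 := by
  -- The bound `q ≤ L * Q` is what carries the induction: the next block meets `A` in `p ≤ Q`
  -- points, so `q + p ≤ (L + 1) * Q` and its coefficient is no larger than the `p` weights
  -- following `W q`.
  have main : ∀ L ≤ K, ∀ A : Finset ℕ, ∃ q ≤ A.card, q ≤ L * Q ∧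
      ∑ i ∈ A, ‖(∑ k ∈ Finset.range L, c k • x k).toSeq i‖ ≤ w.W q := by
    intro L
    induction L with
    | zero => exact fun _ A => ⟨0, by simp [AdmissibleSeq.W_zero]⟩
    | succ L ih =>
      intro hL A
      obtain ⟨q, hq, hqL, hs⟩ := ih (by omega) (A \ T L)
      have hcard : (A ∩ T L).card + (A \ T L).card = A.card :=
        Finset.card_inter_add_card_sdiff A (T L)
      have hpQ : (A ∩ T L).card ≤ Q :=
        (Finset.card_le_card Finset.inter_subset_right).trans (hT L (by omega))
      refine ⟨q + (A ∩ T L).card, by omega, by rw [add_mul, one_mul]; omega, ?_⟩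
      refine le_trans ?_ (w.mul_seq_le_W_sub q (A ∩ T L).card ((L + 1) * Q)
        (by rw [add_mul, one_mul]; omega))
      rw [← Finset.sum_inter_add_sum_sdiff A (T L)]
      simp_rw [Finset.sum_range_succ, toSeq_add_apply, toSeq_smul_apply]
      refine add_le_add ?_ (le_of_eq_of_le (Finset.sum_congr rfl fun i hi => ?_) hs)
      · rw [← nsmul_eq_mul]
        refine Finset.sum_le_card_nsmul _ _ _ fun i hi => ?_
        have hiL := (Finset.mem_inter.1 hi).2
        have h0 : (∑ k ∈ Finset.range L, c k • x k).toSeq i = 0 := by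
          rw [toSeq_sum]
          refine Finset.sum_eq_zero fun k hk => ?_
          have hkL := Finset.mem_range.1 hk
          rw [toSeq_smul_apply, hxT k (by omega) i
            (Finset.disjoint_right.1 (hd L (by omega) k hkL) hiL), mul_zero]
        rw [h0, zero_add, norm_mul]
        exact (mul_le_of_le_one_right (norm_nonneg _)
          ((norm_coord_le _ _).trans (hx L (by omega)))).trans (hc L (by omega))
      · rw [hxT L (by omega) i (Finset.mem_sdiff.1 hi).2, mul_zero, add_zero]
  refine norm_le_of_sum_le fun A _ => ?_
  obtain ⟨q, hq, -, hs⟩ := main K le_rfl A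
  rw [one_mul]
  exact hs.trans (w.W_mono hq)

end LorentzPredual

theorem sum_range_mul_le_of_antitone {f : ℕ → ℝ} (hf : Antitone f) (Q K : ℕ) :
    ∑ i ∈ Finset.range (K * Q), f i ≤ Q * ∑ k ∈ Finset.range K, f (k * Q) := by
  induction K with
  | zero => simp
  | succ K ih =>
    rw [add_mul, one_mul, Finset.sum_range_add, Finset.sum_range_succ, mul_add]
    refine add_le_add ih ?_
    refine (Finset.sum_le_card_nsmul _ _ (f (K * Q)) fun i _ => hf (by omega)).trans_eq ?_
    simp

/-- By monotonicity each block of `Q` consecutive terms is at most `Q` times its first term. -/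
theorem summable_of_summable_mul_of_antitone {f : ℕ → ℝ} (hf : Antitone f) (h0 : ∀ i, 0 ≤ f i)
    {Q : ℕ} (hQ : 1 ≤ Q) (h : Summable fun k => f ((k + 1) * Q)) : Summable f := by
  have h' : Summable fun k => f (k * Q) := (summable_nat_add_iff 1).1 h
  refine summable_of_sum_range_le (c := Q * ∑' k, f (k * Q)) h0 fun n => ?_
  calc ∑ i ∈ Finset.range n, f i ≤ ∑ i ∈ Finset.range (n * Q), f i :=
        Finset.sum_le_sum_of_subset_of_nonneg
          (Finset.range_mono (Nat.le_mul_of_pos_right n hQ)) fun i _ _ => h0 i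
    _ ≤ _ := sum_range_mul_le_of_antitone hf Q n
    _ ≤ _ := mul_le_mul_of_nonneg_left (h'.sum_le_tsum _ fun i _ => h0 _) (Nat.cast_nonneg Q)

namespace AdmissibleSeq

variable (w : AdmissibleSeq)

theorem antitone_pow (m : ℕ) : Antitone fun i => w.seq i ^ m :=
  fun _ _ h => pow_le_pow_left₀ (w.nonneg _) (w.antitone h) m

theorem summable_pow_of_le {j m : ℕ} (hjm : j ≤ m) (h : Summable fun i => w.seq i ^ j) :
    Summable fun i => w.seq i ^ m :=
  h.of_nonneg_of_le (fun i => pow_nonneg (w.nonneg i) m) fun i =>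
    pow_le_pow_of_le_one (w.nonneg i) (w.seq_le_one i) hjm

end AdmissibleSeq

/-! ### Multilinear forms far out. -/

namespace LorentzPredual

variable {𝕜 : Type*} [RCLike 𝕜] {w : AdmissibleSeq}

variable {ι : Type*} [Fintype ι] [DecidableEq ι]

theorem exists_finset_of_encard_le {S : Set ℕ} {Q : ℕ} (h : S.encard ≤ Q) :
    ∃ T : Finset ℕ, T.card ≤ Q ∧ ∀ j ∈ S, j ∈ T := by
  have hfin := Set.finite_of_encard_le_coe h
  lift S to Finset ℕ using hfin
  exact ⟨S, by rw [Set.encard_coe_eq_coe_finsetCard] at h; exact_mod_cast h, fun j hj => hj⟩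

/-- Greedy choice. The next tuple is taken beyond the supports collected so far in the slots `s`,
and in the other slots so flat that, by `exists_norm_add_le`, adding its absolute values raises the
norm by at most `δ`. -/
theorem exists_sequence_of_large (Φ : MultilinearMap 𝕜 (fun _ : ι => LorentzPredual 𝕜 w) 𝕜)
    [Nonempty ι] (s : Finset ι) (Q : ℕ) {ε : ℝ}
    (h : ∀ n : ℕ, ∀ η : ℝ, 0 < η → ∃ x : ι → LorentzPredual 𝕜 w, (∀ i, ‖x i‖ ≤ 1) ∧
      (∀ i ∈ s, ∀ j < n, (x i).toSeq j = 0) ∧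
      (∀ i ∈ s, {j | (x i).toSeq j ≠ 0}.encard ≤ Q) ∧
      (∀ i ∉ s, ∀ j, ‖(x i).toSeq j‖ ≤ η) ∧ ε < ‖Φ x‖) {δ : ℝ} (hδ : 0 < δ) (K : ℕ) :
    ∃ (x : ℕ → ι → LorentzPredual 𝕜 w) (T : ℕ → ι → Finset ℕ),
      (∀ k < K, ∀ i, ‖x k i‖ ≤ 1) ∧ (∀ k < K, ε < ‖Φ (x k)‖) ∧
      (∀ i ∉ s, ‖∑ k ∈ Finset.range K, absVal (x k i)‖ ≤ 1 + K * δ) ∧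
      (∀ k < K, ∀ i ∈ s, (T k i).card ≤ Q) ∧
      (∀ k < K, ∀ i ∈ s, ∀ j ∉ T k i, (x k i).toSeq j = 0) ∧
      (∀ k < K, ∀ j < k, ∀ i ∈ s, Disjoint (T j i) (T k i)) := by
  induction K with
  | zero => exact ⟨fun _ _ => 0, fun _ _ => ∅, by simp⟩
  | succ K ih =>
    obtain ⟨x, T, hx, hε, habs, hcard, hzero, hdisj⟩ := ih
    obtain ⟨n, hn⟩ := Finset.exists_nat_subset_range
      ((Finset.range K).biUnion fun k => Finset.univ.biUnion (T k))
    have hη : ∀ i, ∃ η : ℝ, 0 < η ∧ (i ∉ s → ∀ z : LorentzPredual 𝕜 w, ‖z‖ ≤ 1 →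
        (∀ j, ‖z.toSeq j‖ ≤ η) →
        ‖∑ k ∈ Finset.range K, absVal (x k i) + z‖ ≤ 1 + K * δ + δ) := fun i => by
      by_cases hi : i ∈ s
      · exact ⟨1, one_pos, fun h => absurd hi h⟩
      · obtain ⟨η, h1, h2⟩ := exists_norm_add_le _ (habs i hi)
          (le_add_of_nonneg_right (by positivity)) hδ
        exact ⟨η, h1, fun _ => h2⟩
    choose η hηpos hη using hη
    obtain ⟨z, hz1, hz2, hz3, hz4, hz5⟩ := h n (Finset.univ.inf' Finset.univ_nonempty η)
      ((Finset.lt_inf'_iff _).2 fun i _ => hηpos i)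
    have hT : ∀ i, ∃ U : Finset ℕ, i ∈ s → U.card ≤ Q ∧ (∀ j ∉ U, (z i).toSeq j = 0) ∧
        ∀ j ∈ U, n ≤ j := fun i => by
      by_cases hi : i ∈ s
      · obtain ⟨U, hU1, hU2⟩ := exists_finset_of_encard_le (hz3 i hi)
        refine ⟨{j ∈ U | n ≤ j}, fun _ => ⟨(Finset.card_filter_le _ _).trans hU1, fun j hj => ?_,
          fun j hj => (Finset.mem_filter.1 hj).2⟩⟩
        by_contra hne
        have hjU := hU2 j hne
        refine hne (hz2 i hi j ?_)
        by_contra hlt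
        exact hj (Finset.mem_filter.2 ⟨hjU, not_lt.1 hlt⟩)
      · exact ⟨∅, fun h => absurd h hi⟩
    choose U hU using hT
    have hsucc : ∀ {p : ℕ → Prop}, (∀ k < K, p k) → p K → ∀ k < K + 1, p k :=
      fun h1 h2 k hk => (Nat.lt_succ_iff_lt_or_eq.1 hk).elim (h1 k) fun h => h ▸ h2
    have hxk : ∀ k < K, Function.update x K z k = x k := fun k hk =>
      Function.update_of_ne hk.ne _ _
    have hTk : ∀ k < K, Function.update T K U k = T k := fun k hk =>
      Function.update_of_ne hk.ne _ _
    refine ⟨Function.update x K z, Function.update T K U, ?_, ?_, ?_, ?_, ?_, ?_⟩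
    · exact hsucc (fun k hk => by rw [hxk k hk]; exact hx k hk) (by rwa [Function.update_self])
    · exact hsucc (fun k hk => by rw [hxk k hk]; exact hε k hk) (by rwa [Function.update_self])
    · intro i hi
      rw [Finset.sum_range_succ, Function.update_self, Finset.sum_congr rfl fun k hk => by
        rw [hxk k (Finset.mem_range.1 hk)]]
      push_cast
      rw [add_mul, one_mul, ← add_assoc]
      refine hη i hi _ ((norm_absVal _).trans_le (hz1 i)) fun j => ?_
      rw [toSeq_absVal, RCLike.norm_ofReal, abs_norm]
      exact (hz4 i hi j).trans (Finset.inf'_le _ (Finset.mem_univ i))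
    · exact hsucc (fun k hk => by rw [hTk k hk]; exact hcard k hk)
        (by rw [Function.update_self]; exact fun i hi => (hU i hi).1)
    · exact hsucc (fun k hk => by rw [hTk k hk, hxk k hk]; exact hzero k hk)
        (by rw [Function.update_self, Function.update_self]; exact fun i hi => (hU i hi).2.1)
    · refine hsucc (fun k hk j hj => ?_) fun j hj i hi => ?_
      · rw [hTk k hk, hTk j (hj.trans hk)]
        exact hdisj k hk j hj
      · rw [hTk j hj, Function.update_self, Finset.disjoint_left]
        intro a ha haU
        have h1 := (hU i hi).2.2 a haU
        have h2 := Finset.mem_range.1 (hn (Finset.mem_biUnion.2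
          ⟨j, Finset.mem_range.2 hj, Finset.mem_biUnion.2 ⟨i, Finset.mem_univ i, ha⟩⟩))
        omega

/-- A bounded multilinear form is small at tuples which in the slots `s` have few nonzero
coordinates, all far out, and in the other slots are uniformly small. -/
theorem exists_norm_le_of_sparse_of_flat [Nonempty ι]
    (Φ : MultilinearMap 𝕜 (fun _ : ι => LorentzPredual 𝕜 w) 𝕜) {C : ℝ} (hC : 0 ≤ C)
    (hΦ : ∀ x, ‖Φ x‖ ≤ C * ∏ i, ‖x i‖) (s : Finset ι)
    (hs : ¬ Summable fun i => w.seq i ^ s.card) (Q : ℕ) {ε : ℝ} (hε : 0 < ε) :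
    ∃ n : ℕ, ∃ η : ℝ, 0 < η ∧ ∀ x : ι → LorentzPredual 𝕜 w, (∀ i, ‖x i‖ ≤ 1) →
      (∀ i ∈ s, ∀ j < n, (x i).toSeq j = 0) →
      (∀ i ∈ s, {j | (x i).toSeq j ≠ 0}.encard ≤ Q) →
      (∀ i ∉ s, ∀ j, ‖(x i).toSeq j‖ ≤ η) → ‖Φ x‖ ≤ ε := by
  by_contra! hcon
  -- The block length is `Q + 1` because sampling needs a positive length and `Q` may be 0.
  refine hs (summable_of_summable_mul_of_antitone (w.antitone_pow _)
    (fun i => pow_nonneg (w.nonneg i) _) (Nat.le_add_left 1 Q) ?_)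
  refine summable_of_sum_range_le (c := C * 2 ^ Fintype.card ι / ε)
    (fun i => pow_nonneg (w.nonneg _) _) fun K => ?_
  obtain ⟨x, T, hx, hxε, habs, hcard, hzero, hdisj⟩ := exists_sequence_of_large Φ s (Q + 1)
    (fun n η hη => by
      obtain ⟨x, h1, h2, h3, h4, h5⟩ := hcon n η hη
      exact ⟨x, h1, h2, fun i hi => (h3 i hi).trans (by norm_cast; omega), h4, h5⟩)
    (δ := 1 / (K + 1)) (by positivity) K
  have hKδ : 1 + K * (1 / ((K : ℝ) + 1)) ≤ 2 := by
    have : K * (1 / ((K : ℝ) + 1)) ≤ 1 := by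
      rw [mul_one_div, div_le_one (by positivity)]
      linarith
    linarith
  -- Only the sparse slots carry weights, so the diagonal value at `k` acquires exactly the power
  -- `s.card` of the sampled weight. In every slot, combinations with coefficients of modulus at
  -- most 1 have norm at most 2.
  let y : ι → Fin K → LorentzPredual 𝕜 w := fun i k =>
    (if i ∈ s then ((w.seq ((k + 1) * (Q + 1)) : ℝ) : 𝕜) else 1) • x k i
  have hbound : ∑ k, ‖Φ fun i => y i k‖ ≤ C * 2 ^ Fintype.card ι := by
    refine Φ.sum_norm_diag_le y fun c hc => (hΦ _).trans (mul_le_mul_of_nonneg_left ?_ hC)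
    have hle : ∀ i, ‖∑ k, c i k • y i k‖ ≤ 2 := fun i => by
      by_cases hi : i ∈ s
      · have h1 := norm_sum_smul_le_of_disjoint (𝕜 := 𝕜) (w := w) (Q + 1) (fun k => x k i)
          (fun k => T k i)
          (fun k => if hk : k < K then c i ⟨k, hk⟩ * ((w.seq ((k + 1) * (Q + 1)) : ℝ) : 𝕜) else 0) K
          (fun k hk => hx k hk i) (fun k hk => hcard k hk i hi) (fun k hk => hzero k hk i hi)
          (fun k hk j hj => hdisj k hk j hj i hi) (fun k hk => by
            rw [dif_pos hk, norm_mul, RCLike.norm_ofReal, abs_of_nonneg (w.nonneg _)]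
            exact mul_le_of_le_one_left (w.nonneg _) (hc _ _))
        rw [Finset.sum_range] at h1
        refine le_trans (le_of_eq ?_) (h1.trans one_le_two)
        simp [y, hi, smul_smul]
      · refine le_trans (norm_le_norm_of_coord fun j => ?_) ((habs i hi).trans hKδ)
        rw [toSeq_sum, toSeq_sum, Finset.sum_range]
        simp only [toSeq_absVal, y, hi, if_false, one_smul, toSeq_smul_apply]
        rw [← RCLike.ofReal_sum, RCLike.norm_ofReal,
          abs_of_nonneg (Finset.sum_nonneg fun _ _ => norm_nonneg _)]
        refine norm_sum_le_of_le _ fun k _ => ?_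
        rw [norm_mul]
        exact mul_le_of_le_one_left (norm_nonneg _) (hc _ _)
    exact (Finset.prod_le_prod (fun i _ => norm_nonneg _) fun i _ => hle i).trans_eq (by simp)
  rw [le_div_iff₀ hε, Finset.sum_mul, Finset.sum_range]
  refine le_trans (Finset.sum_le_sum fun k _ => ?_) hbound
  have hy : (Φ fun i => y i k) = (((w.seq ((k + 1) * (Q + 1)) : ℝ) : 𝕜)) ^ s.card * Φ (x k) := by
    have h1 := Φ.map_smul_univ
      (fun i => if i ∈ s then ((w.seq ((k + 1) * (Q + 1)) : ℝ) : 𝕜) else 1) (x k)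
    rw [Finset.prod_ite_mem, Finset.univ_inter, Finset.prod_const, smul_eq_mul] at h1
    exact h1
  rw [hy, norm_mul, norm_pow, RCLike.norm_ofReal, abs_of_nonneg (w.nonneg _)]
  exact mul_le_mul_of_nonneg_left (hxε k k.2).le (pow_nonneg (w.nonneg _) _)

/-- A bounded multilinear form of degree `m` with `w ∉ ℓ_m` is small far out. -/
theorem exists_norm_le_of_tails_aux [Nonempty ι]
    (Φ : MultilinearMap 𝕜 (fun _ : ι => LorentzPredual 𝕜 w) 𝕜) {C : ℝ} (hC : 0 ≤ C)
    (hΦ : ∀ x, ‖Φ x‖ ≤ C * ∏ i, ‖x i‖)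
    (hw : ¬ Summable fun i => w.seq i ^ Fintype.card ι) (s : Finset ι) (Q : ℕ) {ε : ℝ}
    (hε : 0 < ε) :
    ∃ n : ℕ, ∀ x : ι → LorentzPredual 𝕜 w, (∀ i, ‖x i‖ ≤ 1) →
      (∀ i, ∀ j < n, (x i).toSeq j = 0) →
      (∀ i ∈ s, {j | (x i).toSeq j ≠ 0}.encard ≤ Q) → ‖Φ x‖ ≤ ε := by
  induction h : sᶜ.card using Nat.strong_induction_on generalizing s Q ε with
  -- Induction on the number of slots outside `s`, those not yet known to be sparse.
  | _ d ih =>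
  obtain ⟨n₀, η, hη, hsmall⟩ := exists_norm_le_of_sparse_of_flat Φ hC hΦ s
    (fun hs => hw (w.summable_pow_of_le (Finset.card_le_univ s) hs)) Q (half_pos hε)
  obtain ⟨Q', hQ'⟩ := exists_card_large_coord_le 𝕜 w hη
  have hF : (0 : ℝ) < Fintype.card (Finset ι) := by exact_mod_cast Fintype.card_pos
  have hstep : ∀ t : Finset ι, ∃ n : ℕ, s ⊂ t → ∀ x : ι → LorentzPredual 𝕜 w, (∀ i, ‖x i‖ ≤ 1) →
      (∀ i, ∀ j < n, (x i).toSeq j = 0) →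
      (∀ i ∈ t, {j | (x i).toSeq j ≠ 0}.encard ≤ (max Q Q' : ℕ)) →
      ‖Φ x‖ ≤ ε / 2 / Fintype.card (Finset ι) := fun t => by
    by_cases hst : s ⊂ t
    · have hlt : tᶜ.card < d := h ▸ Finset.card_lt_card (Finset.compl_ssubset_compl.2 hst)
      obtain ⟨n, hn⟩ := ih _ hlt t (max Q Q') (div_pos (half_pos hε) hF) rfl
      exact ⟨n, fun _ => hn⟩
    · exact ⟨0, fun h => absurd h hst⟩
  choose n hn using hstep
  refine ⟨max n₀ (Finset.univ.sup n), fun x hx hx0 hxQ => ?_⟩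
  -- In each slot outside `s`, `y` is the sparse part above height `η` and `z` the flat rest. In the
  -- expansion the choice `t = s` is sparse in `s` and flat elsewhere; a larger `t` has more sparse
  -- slots and falls to the induction; any other `t` puts a zero into some slot of `s`.
  let L : ι → Set ℕ := fun i => {j | η < ‖(x i).toSeq j‖}
  let y : ι → LorentzPredual 𝕜 w := fun i => if i ∈ s then x i else mask (L i) (x i)
  let z : ι → LorentzPredual 𝕜 w := fun i => if i ∈ s then 0 else mask (L i)ᶜ (x i)
  have hxyz : x = y + z := by
    funext i
    by_cases hi : i ∈ s
    · simp [y, z, hi]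
    · simp [y, z, hi, mask_add_mask_compl]
  have hyx : ∀ i j, ‖(y i).toSeq j‖ ≤ ‖(x i).toSeq j‖ := fun i j => by
    by_cases hi : i ∈ s
    · simp [y, hi]
    · simpa [y, hi] using norm_toSeq_mask_le _ _ _
  have hzx : ∀ i j, ‖(z i).toSeq j‖ ≤ ‖(x i).toSeq j‖ := fun i j => by
    by_cases hi : i ∈ s
    · simp [z, hi]
    · simpa [z, hi] using norm_toSeq_mask_le _ _ _
  have hpx : ∀ t : Finset ι, ∀ i j, ‖(t.piecewise y z i).toSeq j‖ ≤ ‖(x i).toSeq j‖ :=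
    fun t i j => by
      by_cases hi : i ∈ t
      · simpa [hi] using hyx i j
      · simpa [hi] using hzx i j
  have hp1 : ∀ t : Finset ι, ∀ i, ‖t.piecewise y z i‖ ≤ 1 := fun t i =>
    (norm_le_norm_of_coord (hpx t i)).trans (hx i)
  have hp0 : ∀ t : Finset ι, ∀ i, ∀ j < max n₀ (Finset.univ.sup n),
      (t.piecewise y z i).toSeq j = 0 := fun t i j hj => by
    have h1 := hpx t i j
    rw [hx0 i j hj, norm_zero] at h1
    exact norm_le_zero_iff.1 h1
  have hyQ : ∀ i, {j | (y i).toSeq j ≠ 0}.encard ≤ (max Q Q' : ℕ) := fun i => by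
    by_cases hi : i ∈ s
    · simp only [y, hi, if_true]
      exact (hxQ i hi).trans (by norm_cast; omega)
    · refine le_trans (Set.encard_le_encard fun j hj => ?_)
        ((hQ' (x i) (hx i)).trans (by norm_cast; omega))
      by_contra hjL
      simp only [y, hi, if_false] at hj
      exact hj (toSeq_mask_of_notMem hjL _)
  have hterm : ∀ t : Finset ι, ‖Φ (t.piecewise y z)‖ ≤
      (if t = s then ε / 2 else 0) + ε / 2 / Fintype.card (Finset ι) := fun t => by
    have hnn : 0 ≤ ε / 2 / Fintype.card (Finset ι) := by positivity
    by_cases hts : t = s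
    · subst hts
      rw [if_pos rfl]
      refine (hsmall _ (hp1 t) (fun i _ j hj => hp0 t i j (lt_max_of_lt_left hj))
        (fun i hi => ?_) fun i hi j => ?_).trans (le_add_of_nonneg_right hnn)
      · rw [Finset.piecewise_eq_of_mem _ _ _ hi]
        simpa only [y, hi, if_true] using hxQ i hi
      · rw [Finset.piecewise_eq_of_notMem _ _ _ hi]
        simp only [z, hi, if_false]
        by_cases hj : j ∈ L i
        · rw [toSeq_mask_of_notMem (by simpa using hj)]
          simpa using hη.le
        · rw [toSeq_mask_of_mem (by simpa using hj)]
          exact not_lt.1 hj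
    rw [if_neg hts, zero_add]
    by_cases hst : s ⊆ t
    · refine hn t (Finset.ssubset_iff_subset_ne.2 ⟨hst, Ne.symm hts⟩) _ (hp1 t) (fun i j hj =>
        hp0 t i j (lt_max_of_lt_right (hj.trans_le (Finset.le_sup (Finset.mem_univ t)))))
        fun i hi => ?_
      rw [Finset.piecewise_eq_of_mem _ _ _ hi]
      exact hyQ i
    · obtain ⟨i, his, hit⟩ := Finset.not_subset.1 hst
      rw [Φ.map_coord_zero i (by rw [Finset.piecewise_eq_of_notMem _ _ _ hit]; simp [z, his]),
        norm_zero]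
      exact hnn
  rw [hxyz, Φ.map_add_univ]
  refine (norm_sum_le_of_le _ fun t _ => hterm t).trans_eq ?_
  rw [Finset.sum_add_distrib, Finset.sum_ite_eq' Finset.univ s, if_pos (Finset.mem_univ s),
    Finset.sum_const, nsmul_eq_mul, Finset.card_univ, mul_div_cancel₀ _ hF.ne']
  ring

-- Freezing slots at points of the unit ball keeps the constant `C`. The `Fintype` instance on the
-- free slots is arbitrary so that the bound applies whichever instance arises.
omit [DecidableEq ι] in
theorem norm_domDomRestrict_le {Φ : MultilinearMap 𝕜 (fun _ : ι => LorentzPredual 𝕜 w) 𝕜} {C : ℝ}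
    (hC : 0 ≤ C) (hΦ : ∀ x, ‖Φ x‖ ≤ C * ∏ i, ‖x i‖) (P : ι → Prop) [DecidablePred P]
    [hf : Fintype {a : ι // P a}] (z : {a : ι // ¬ P a} → LorentzPredual 𝕜 w) (hz : ∀ i, ‖z i‖ ≤ 1)
    (x : {a : ι // P a} → LorentzPredual 𝕜 w) :
    ‖Φ.domDomRestrict P z x‖ ≤ C * ∏ i, ‖x i‖ := by
  obtain rfl : hf = Subtype.fintype P := Subsingleton.elim _ _
  rw [MultilinearMap.domDomRestrict_apply]
  refine (hΦ _).trans (mul_le_mul_of_nonneg_left ?_ hC)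
  rw [← Fintype.prod_subtype_mul_prod_subtype P]
  have h1 : ∀ i : {a : ι // P a}, (if h : P i then x ⟨i, h⟩ else z ⟨i, h⟩) = x i := fun i => by
    simp [i.2]
  have h2 : ∀ i : {a : ι // ¬ P a}, (if h : P i then x ⟨i, h⟩ else z ⟨i, h⟩) = z i := fun i => by
    simp [i.2]
  simp_rw [h1, h2]
  exact mul_le_of_le_one_right (Finset.prod_nonneg fun _ _ => norm_nonneg _)
    (Finset.prod_le_one (fun _ _ => norm_nonneg _) fun i _ => hz i)

end LorentzPredual

namespace LorentzPredual

variable {𝕜 : Type*} [RCLike 𝕜] {w : AdmissibleSeq}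

/-- A bounded multilinear form of degree `m` with `w ∉ ℓ_m` is small on tuples of the unit ball as
soon as one of the entries lives far out. -/
theorem exists_norm_le_of_tail {ι : Type} [Fintype ι] [DecidableEq ι]
    (Φ : MultilinearMap 𝕜 (fun _ : ι => LorentzPredual 𝕜 w) 𝕜) {C : ℝ} (hC : 0 ≤ C)
    (hΦ : ∀ x, ‖Φ x‖ ≤ C * ∏ i, ‖x i‖)
    (hw : ¬ Summable fun i => w.seq i ^ Fintype.card ι) {ε : ℝ} (hε : 0 < ε) :
    ∃ n : ℕ, ∀ x : ι → LorentzPredual 𝕜 w, (∀ i, ‖x i‖ ≤ 1) →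
      ∀ i, (∀ j < n, (x i).toSeq j = 0) → ‖Φ x‖ ≤ ε := by
  induction hd : Fintype.card ι using Nat.strong_induction_on generalizing ι ε with
  | _ d ih =>
  rcases isEmpty_or_nonempty ι with he | hne
  · exact ⟨0, fun _ _ i => he.elim i⟩
  obtain ⟨n₀, hn₀⟩ := exists_norm_le_of_tails_aux Φ hC hΦ hw ∅ 0 (half_pos hε)
  have hF : (0 : ℝ) < Fintype.card (Finset ι) := by exact_mod_cast Fintype.card_pos
  -- A slot that holds a head is expanded in the unit vectors `e_l` with `l < n₀`; freezing it at
  -- each `e_l` leaves forms with one slot fewer, in which slot `i` still lives far out. The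
  -- denominator `n₀ + 1` shares `ε` among the `n₀` vectors and stays positive when `n₀ = 0`.
  have hstep : ∀ (i₀ : ι) (l : ℕ), ∃ n : ℕ, ∀ x : {i // i ≠ i₀} → LorentzPredual 𝕜 w,
      (∀ i, ‖x i‖ ≤ 1) → ∀ i, (∀ j < n, (x i).toSeq j = 0) →
      ‖Φ.domDomRestrict (· ≠ i₀) (fun _ => unitVec l) x‖ ≤
        ε / 2 / Fintype.card (Finset ι) / (n₀ + 1) := fun i₀ l => by
    have hlt : Fintype.card {i // i ≠ i₀} < d := by
      rw [← hd]
      exact Fintype.card_subtype_lt (x := i₀) (by simp)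
    exact ih _ hlt _ (norm_domDomRestrict_le hC hΦ _ _ fun _ => norm_unitVec_le l)
      (fun h => hw (w.summable_pow_of_le (hd ▸ hlt.le) h)) (by positivity) rfl
  choose n hn using hstep
  refine ⟨max n₀ (Finset.univ.sup fun i₀ => (Finset.range n₀).sup (n i₀)), fun x hx i hi => ?_⟩
  let y : ι → LorentzPredual 𝕜 w := fun i => mask (Set.Iio n₀)ᶜ (x i)
  let z : ι → LorentzPredual 𝕜 w := fun i => mask (Set.Iio n₀) (x i)
  have hxyz : x = y + z := funext fun i => by
    rw [Pi.add_apply, add_comm]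
    exact (mask_add_mask_compl _ _).symm
  have hp1 : ∀ t : Finset ι, ∀ i, ‖t.piecewise y z i‖ ≤ 1 := fun t i => by
    by_cases hi : i ∈ t
    · simpa [hi] using (norm_mask_le _ _).trans (hx i)
    · simpa [hi] using (norm_mask_le _ _).trans (hx i)
  have hzi : z i = 0 := by
    ext j
    by_cases hj : j ∈ Set.Iio n₀
    · rw [toSeq_mask_of_mem hj]
      exact hi j (lt_max_of_lt_left hj)
    · rw [toSeq_mask_of_notMem hj]
      rfl
  have hterm : ∀ t : Finset ι, ‖Φ (t.piecewise y z)‖ ≤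
      (if t = Finset.univ then ε / 2 else 0) + ε / 2 / Fintype.card (Finset ι) := fun t => by
    have hnn : 0 ≤ ε / 2 / Fintype.card (Finset ι) := by positivity
    by_cases ht : t = Finset.univ
    · subst ht
      rw [if_pos rfl]
      refine (hn₀ _ (hp1 _) (fun i j hj => ?_) (by simp)).trans (le_add_of_nonneg_right hnn)
      rw [Finset.piecewise_univ]
      exact toSeq_mask_of_notMem (by simpa using hj) _
    rw [if_neg ht, zero_add]
    obtain ⟨i₀, hi₀⟩ : ∃ i₀, i₀ ∉ t := by
      by_contra! hall
      exact ht (Finset.eq_univ_iff_forall.2 hall)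
    by_cases hit : i ∈ t
    · have hne : i ≠ i₀ := fun h => hi₀ (h ▸ hit)
      have hexp : Φ (t.piecewise y z) = ∑ l ∈ Finset.range n₀, (x i₀).toSeq l *
          Φ.domDomRestrict (· ≠ i₀) (fun _ => unitVec l) fun a => t.piecewise y z a := by
        have h1 : t.piecewise y z = Function.update (t.piecewise y z) i₀
            (∑ l ∈ Finset.range n₀, (x i₀).toSeq l • unitVec l) := by
          rw [← mask_Iio_eq_sum, Function.eq_update_iff]
          exact ⟨by rw [Finset.piecewise_eq_of_notMem _ _ _ hi₀], fun _ _ => rfl⟩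
        conv_lhs => rw [h1]
        rw [Φ.map_update_sum]
        refine Finset.sum_congr rfl fun l _ => ?_
        rw [Φ.map_update_smul, smul_eq_mul, MultilinearMap.domDomRestrict_apply]
        congr 2
        funext a
        by_cases ha : a = i₀
        · subst ha
          simp
        · simp [ha]
      rw [hexp]
      refine (norm_sum_le_of_le (n := fun _ => ε / 2 / Fintype.card (Finset ι) / (n₀ + 1)) _
        fun l hl => ?_).trans ?_
      · rw [norm_mul]
        refine (mul_le_of_le_one_left (norm_nonneg _)
          ((norm_coord_le _ _).trans (hx i₀))).trans ?_
        refine hn i₀ l _ (fun a => hp1 t a) ⟨i, hne⟩ fun j hj => ?_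
        rw [Finset.piecewise_eq_of_mem _ _ _ hit]
        refine norm_le_zero_iff.1 ((norm_toSeq_mask_le _ _ _).trans_eq ?_)
        rw [hi j (lt_max_of_lt_right (hj.trans_le ?_)), norm_zero]
        exact (Finset.le_sup (f := n i₀) hl).trans
          (Finset.le_sup (f := fun i₀ => (Finset.range n₀).sup (n i₀)) (Finset.mem_univ i₀))
      · rw [Finset.sum_const, Finset.card_range, nsmul_eq_mul, mul_div_assoc',
          div_le_iff₀ (by positivity), mul_comm]
        exact mul_le_mul_of_nonneg_left (by linarith) hnn
    · rw [Φ.map_coord_zero i (by rw [Finset.piecewise_eq_of_notMem _ _ _ hit, hzi]), norm_zero]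
      exact hnn
  rw [hxyz, Φ.map_add_univ]
  refine (norm_sum_le_of_le _ fun t _ => hterm t).trans_eq ?_
  rw [Finset.sum_add_distrib, Finset.sum_ite_eq' Finset.univ (Finset.univ : Finset ι),
    if_pos (Finset.mem_univ _), Finset.sum_const, nsmul_eq_mul, Finset.card_univ,
    mul_div_cancel₀ _ hF.ne']
  ring

/-- The projection to the first `n` coordinates, as a continuous linear map. -/
noncomputable def headProj (n : ℕ) : LorentzPredual 𝕜 w →L[𝕜] LorentzPredual 𝕜 w :=
  (mask (Set.Iio n)).mkContinuous 1 fun x => by simpa using norm_mask_le _ x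

theorem headProj_apply (n : ℕ) (x : LorentzPredual 𝕜 w) : headProj n x = mask (Set.Iio n) x := rfl

/-- Splitting `x` into head and tail in every slot, the difference consists of exactly the terms
with a tail in some slot. Constants are treated apart, having no slot. -/
theorem exists_norm_sub_headProj_le {j : ℕ} {P : LorentzPredual 𝕜 w → 𝕜}
    (hP : IsHomogeneousPoly 𝕜 j P) (hw : j ≠ 0 → ¬ Summable fun i => w.seq i ^ j) {ε : ℝ}
    (hε : 0 < ε) : ∃ n₀ : ℕ, ∀ n ≥ n₀, ∀ x : LorentzPredual 𝕜 w, ‖x‖ ≤ 1 →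
      ‖P x - P (headProj n x)‖ ≤ ε := by
  obtain ⟨Φ, hΦ⟩ := hP
  rcases eq_or_ne j 0 with rfl | hj
  · refine ⟨0, fun n _ x _ => ?_⟩
    rw [hΦ, hΦ, Subsingleton.elim (fun _ : Fin 0 => x) fun _ => headProj n x, sub_self, norm_zero]
    exact hε.le
  have hF : (0 : ℝ) < Fintype.card (Finset (Fin j)) := by exact_mod_cast Fintype.card_pos
  obtain ⟨n₀, hn₀⟩ := exists_norm_le_of_tail Φ.toMultilinearMap (norm_nonneg Φ)
    (fun x => Φ.le_opNorm x) (by simpa using hw hj) (div_pos hε hF)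
  refine ⟨n₀, fun n hn x hx => ?_⟩
  have hx' : (fun _ : Fin j => x) =
      (fun _ => mask (Set.Iio n)ᶜ x) + fun _ => mask (Set.Iio n) x := funext fun _ => by
    rw [Pi.add_apply, add_comm]
    exact (mask_add_mask_compl _ _).symm
  have hsum : P x - P (headProj n x) = ∑ t ∈ Finset.univ.erase (∅ : Finset (Fin j)),
      Φ (t.piecewise (fun _ => mask (Set.Iio n)ᶜ x) fun _ => mask (Set.Iio n) x) := by
    rw [hΦ, hΦ, hx', Φ.map_add_univ, ← Finset.add_sum_erase _ _ (Finset.mem_univ ∅),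
      Finset.piecewise_empty]
    simp only [headProj_apply]
    ring
  rw [hsum]
  refine (norm_sum_le_of_le (n := fun _ => ε / Fintype.card (Finset (Fin j))) _
    fun t ht => ?_).trans ?_
  · obtain ⟨i, hi⟩ := Finset.nonempty_iff_ne_empty.2 (Finset.ne_of_mem_erase ht)
    refine hn₀ _ (fun a => ?_) i fun l hl => ?_
    · by_cases ha : a ∈ t
      · simpa [ha] using (norm_mask_le _ _).trans hx
      · simpa [ha] using (norm_mask_le _ _).trans hx
    · rw [Finset.piecewise_eq_of_mem _ _ _ hi]
      exact toSeq_mask_of_notMem (by simpa using hl.trans_le hn) _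
  · rw [Finset.sum_const, nsmul_eq_mul]
    refine (mul_le_mul_of_nonneg_right (Nat.cast_le.2 (Finset.card_le_univ _))
      (by positivity)).trans_eq (mul_div_cancel₀ _ hF.ne')

end LorentzPredual

/-! ### Density: polynomials in finitely many coordinates. -/

section CompContinuousLinear

variable {𝕜 X Y : Type*} [RCLike 𝕜] [NormedAddCommGroup X] [NormedSpace 𝕜 X]
  [NormedAddCommGroup Y] [NormedSpace 𝕜 Y]

theorem IsHomogeneousPoly.comp {j : ℕ} {P : Y → 𝕜} (hP : IsHomogeneousPoly 𝕜 j P) (L : X →L[𝕜] Y) :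
    IsHomogeneousPoly 𝕜 j fun x => P (L x) := by
  obtain ⟨Φ, hΦ⟩ := hP
  exact ⟨Φ.compContinuousLinearMap fun _ => L, fun x => hΦ (L x)⟩

theorem IsHomogeneousPoly.continuous {j : ℕ} {P : X → 𝕜} (hP : IsHomogeneousPoly 𝕜 j P) :
    Continuous P := by
  obtain ⟨Φ, hΦ⟩ := hP
  rw [funext hΦ]
  exact Φ.cont.comp (continuous_pi fun _ => continuous_id)

namespace PolyDegLE

variable {N : ℕ}

theorem continuous (P : PolyDegLE 𝕜 X N) : Continuous (P : X → 𝕜) := by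
  obtain ⟨Q, hQ, hP⟩ := P.2
  refine (continuous_finsetSum (Finset.range (N + 1)) fun j _ => (hQ j).continuous).congr fun x => ?_
  rw [hP, Finset.sum_apply]

/-- The composition of a polynomial with a continuous linear map. -/
def comp (P : PolyDegLE 𝕜 Y N) (L : X →L[𝕜] Y) : PolyDegLE 𝕜 X N :=
  ⟨fun x => P (L x), by
    obtain ⟨Q, hQ, hP⟩ := P.2
    exact ⟨fun j x => Q j (L x), fun j => (hQ j).comp L, funext fun x => by
      rw [hP, Finset.sum_apply, Finset.sum_apply]⟩⟩

theorem comp_apply (P : PolyDegLE 𝕜 Y N) (L : X →L[𝕜] Y) (x : X) : P.comp L x = P (L x) := rfl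

theorem sub_apply (P Q : PolyDegLE 𝕜 X N) (x : X) : (P - Q) x = P x - Q x := rfl

end PolyDegLE

end CompContinuousLinear

namespace LorentzPredual

variable {𝕜 : Type*} [RCLike 𝕜] {w : AdmissibleSeq}

theorem exists_norm_poly_sub_comp_headProj_le {N : ℕ} (hw : ¬ Summable fun i => w.seq i ^ N)
    (P : PolyDegLE 𝕜 (LorentzPredual 𝕜 w) N) {ε : ℝ} (hε : 0 < ε) :
    ∃ n, ‖P - P.comp (headProj n)‖ ≤ ε := by
  obtain ⟨Q, hQ, hP⟩ := P.2
  have h : ∀ j, ∃ n₀, j ≤ N → ∀ n ≥ n₀, ∀ x : LorentzPredual 𝕜 w, ‖x‖ ≤ 1 →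
      ‖Q j x - Q j (headProj n x)‖ ≤ ε / (N + 1) := fun j => by
    by_cases hj : j ≤ N
    · obtain ⟨n₀, hn₀⟩ := exists_norm_sub_headProj_le (hQ j)
        (fun _ hs => hw (w.summable_pow_of_le hj hs)) (ε := ε / (N + 1)) (by positivity)
      exact ⟨n₀, fun _ => hn₀⟩
    · exact ⟨0, fun h => absurd h hj⟩
  choose n hn using h
  refine ⟨(Finset.range (N + 1)).sup n, PolyDegLE.norm_le_of_forall _ fun x hx => ?_⟩
  rw [PolyDegLE.sub_apply, PolyDegLE.comp_apply, hP, Finset.sum_apply, Finset.sum_apply,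
    ← Finset.sum_sub_distrib]
  refine (norm_sum_le_of_le _ fun j hj => hn j (by simpa [Nat.lt_succ_iff] using hj) _
    (Finset.le_sup hj) x hx).trans_eq ?_
  rw [Finset.sum_const, Finset.card_range, nsmul_eq_mul]
  push_cast
  field_simp

/-- The inclusion of finitely supported sequences. -/
noncomputable def finiteIncl (n : ℕ) : (Fin n → 𝕜) →L[𝕜] LorentzPredual 𝕜 w :=
  ∑ i : Fin n, (ContinuousLinearMap.proj i : (Fin n → 𝕜) →L[𝕜] 𝕜).smulRight (unitVec (i : ℕ))

theorem finiteIncl_apply (n : ℕ) (c : Fin n → 𝕜) :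
    (finiteIncl n c : LorentzPredual 𝕜 w) = ∑ i : Fin n, c i • unitVec (i : ℕ) := by
  simp [finiteIncl]

theorem toSeq_finiteIncl (n : ℕ) (c : Fin n → 𝕜) (i : Fin n) :
    (finiteIncl n c : LorentzPredual 𝕜 w).toSeq i = c i := by
  rw [finiteIncl_apply, toSeq_sum]
  simp [toSeq_unitVec, Fin.val_inj]

theorem headProj_eq_finiteIncl (n : ℕ) (x : LorentzPredual 𝕜 w) :
    headProj n x = finiteIncl n fun i => x.toSeq i := by
  rw [headProj_apply, mask_Iio_eq_sum, finiteIncl_apply, Finset.sum_range]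

theorem normAttaining_comp_headProj {N : ℕ} (P : PolyDegLE 𝕜 (LorentzPredual 𝕜 w) N) (n : ℕ) :
    (P.comp (headProj n)).NormAttaining := by
  -- Coordinates are bounded by the norm, so this is a closed subset of a finite-dimensional cube.
  have hcomp : IsCompact {c : Fin n → 𝕜 | ‖(finiteIncl n c : LorentzPredual 𝕜 w)‖ ≤ 1} := by
    refine (isCompact_closedBall (0 : Fin n → 𝕜) 1).of_isClosed_subset
      (isClosed_le (finiteIncl n).continuous.norm continuous_const) fun c hc => ?_
    rw [mem_closedBall_zero_iff, pi_norm_le_iff_of_nonneg zero_le_one]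
    intro i
    rw [← toSeq_finiteIncl (w := w) n c i]
    exact (norm_coord_le _ _).trans hc
  obtain ⟨c, hc, hmax⟩ := hcomp.exists_isMaxOn ⟨0, by simp⟩
    (P.continuous.comp (finiteIncl n).continuous).norm.continuousOn
  have hproj : headProj n (finiteIncl n c : LorentzPredual 𝕜 w) = finiteIncl n c := by
    rw [headProj_eq_finiteIncl]
    simp_rw [toSeq_finiteIncl]
  refine ⟨finiteIncl n c, hc, le_antisymm (PolyDegLE.norm_apply_le _ hc)
    (PolyDegLE.norm_le_of_forall _ fun x hx => ?_)⟩
  rw [PolyDegLE.comp_apply, PolyDegLE.comp_apply, hproj, headProj_eq_finiteIncl]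
  refine hmax (?_ : ‖(finiteIncl n _ : LorentzPredual 𝕜 w)‖ ≤ 1)
  rw [← headProj_eq_finiteIncl]
  exact (norm_mask_le _ _).trans hx

theorem dense_normAttaining {N : ℕ} (hw : ¬ Summable fun i => w.seq i ^ N) :
    Dense {P : PolyDegLE 𝕜 (LorentzPredual 𝕜 w) N | P.NormAttaining} := by
  refine Metric.dense_iff.2 fun P r hr => ?_
  obtain ⟨n, hn⟩ := exists_norm_poly_sub_comp_headProj_le hw P (half_pos hr)
  refine ⟨P.comp (headProj n), ?_, normAttaining_comp_headProj P n⟩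
  rw [Metric.mem_ball, dist_comm, dist_eq_norm]
  linarith

end LorentzPredual

/-! ### Majorization and coefficient bounds. -/

/-- The graph of `t ↦ t ^ (m + 1)` lies above its tangent at `a`, on the half-line. -/
theorem pow_add_mul_sub_le_pow {a b : ℝ} (ha : 0 ≤ a) (hb : 0 ≤ b) (m : ℕ) :
    a ^ (m + 1) + (m + 1) * a ^ m * (b - a) ≤ b ^ (m + 1) := by
  induction m with
  | zero => simp
  | succ m ih =>
    have h1 := mul_le_mul_of_nonneg_left ih hb
    have h2 : 0 ≤ (m + 1) * a ^ m * (b - a) ^ 2 := by positivity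
    push_cast
    calc a ^ (m + 1 + 1) + (m + 1 + 1) * a ^ (m + 1) * (b - a)
        = b * (a ^ (m + 1) + (m + 1) * a ^ m * (b - a)) - (m + 1) * a ^ m * (b - a) ^ 2 := by ring
      _ ≤ b * b ^ (m + 1) := by linarith
      _ = b ^ (m + 1 + 1) := by ring

/-- Abel summation, in the sharper inductive form that compares with `b n` times the full partial
sum of `d`. -/
theorem sum_mul_nonneg_of_antitone {b d : ℕ → ℝ} (hb : Antitone b) (hb0 : ∀ i, 0 ≤ b i)
    (hd : ∀ n, 0 ≤ ∑ i ∈ Finset.range n, d i) (n : ℕ) : 0 ≤ ∑ i ∈ Finset.range n, b i * d i := by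
  have main : ∀ n, b n * ∑ i ∈ Finset.range (n + 1), d i ≤
      ∑ i ∈ Finset.range (n + 1), b i * d i := by
    intro n
    induction n with
    | zero => simp
    | succ n ih =>
      rw [Finset.sum_range_succ _ (n + 1), Finset.sum_range_succ _ (n + 1), mul_add]
      have := mul_le_mul_of_nonneg_right (hb n.le_succ) (hd (n + 1))
      linarith
  rcases n with _ | n
  · simp
  · exact (mul_nonneg (hb0 n) (hd _)).trans (main n)

/-- Power sums are monotone under majorization. -/
theorem sum_pow_le_sum_pow_of_antitone {a b : ℕ → ℝ} (ha : Antitone a) (ha0 : ∀ i, 0 ≤ a i)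
    (hb0 : ∀ i, 0 ≤ b i)
    (h : ∀ n, ∑ i ∈ Finset.range n, a i ≤ ∑ i ∈ Finset.range n, b i) (m n : ℕ) :
    ∑ i ∈ Finset.range n, a i ^ (m + 1) ≤ ∑ i ∈ Finset.range n, b i ^ (m + 1) := by
  -- The slopes of the tangents at the `a i` are decreasing, and the partial sums of `b - a` are
  -- nonnegative; so the linear terms add up to something nonnegative.
  have h1 := sum_mul_nonneg_of_antitone (b := fun i => (m + 1) * a i ^ m) (d := fun i => b i - a i)
    (fun i j hij => mul_le_mul_of_nonneg_left (pow_le_pow_left₀ (ha0 j) (ha hij) m) (by positivity))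
    (fun i => mul_nonneg (by positivity) (pow_nonneg (ha0 i) m))
    (fun n => by rw [Finset.sum_sub_distrib]; linarith [h n]) n
  have h2 := Finset.sum_le_sum fun i (_ : i ∈ Finset.range n) =>
    pow_add_mul_sub_le_pow (ha0 i) (hb0 i) m
  rw [Finset.sum_add_distrib] at h2
  linarith

/-- A polynomial of degree at most `N` is recovered from its values at the `N + 1` nodes `i/(N + 1)`
by inverting a Vandermonde matrix, and the nodes lie in the unit ball of `𝕜`. -/
theorem exists_coeff_le (𝕜 : Type*) [RCLike 𝕜] (N : ℕ) : ∃ C : ℝ, 0 ≤ C ∧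
    ∀ (c : ℕ → 𝕜) (r : ℝ), (∀ t : 𝕜, ‖t‖ ≤ 1 → ‖∑ j ∈ Finset.range (N + 1), c j * t ^ j‖ ≤ r) →
      ∀ j ≤ N, ‖c j‖ ≤ C * r := by
  let v : Fin (N + 1) → 𝕜 := fun i => ((i : ℕ) : 𝕜) / ((N + 1 : ℕ) : 𝕜)
  have hN : ((N + 1 : ℕ) : 𝕜) ≠ 0 := Nat.cast_ne_zero.2 (Nat.succ_ne_zero N)
  have hv : Function.Injective v := fun i j hij => by
    exact Fin.ext (Nat.cast_injective ((div_left_inj' hN).1 hij))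
  have hv1 : ∀ i, ‖v i‖ ≤ 1 := fun i => by
    rw [norm_div, RCLike.norm_natCast, RCLike.norm_natCast, div_le_one (by positivity)]
    exact_mod_cast i.2.le
  set V := Matrix.vandermonde v with hV
  have hdet : IsUnit V.det := isUnit_iff_ne_zero.2 (Matrix.det_vandermonde_ne_zero_iff.2 hv)
  refine ⟨∑ i, ∑ k, ‖V⁻¹ i k‖, by positivity, fun c r hr j hj => ?_⟩
  have hr0 : 0 ≤ r := (norm_nonneg _).trans (hr 0 (by simp))
  have hval : ∀ k, ‖(V.mulVec fun i => c i) k‖ ≤ r := fun k => by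
    refine le_trans (le_of_eq ?_) (hr (v k) (hv1 k))
    rw [Finset.sum_range]
    simp [Matrix.mulVec, dotProduct, hV, Matrix.vandermonde_apply, mul_comm]
  have hc : c j = ∑ k, V⁻¹ ⟨j, by omega⟩ k * (V.mulVec fun i => c i) k := by
    have h1 : V⁻¹.mulVec (V.mulVec fun i : Fin (N + 1) => c i) = fun i : Fin (N + 1) => c i := by
      rw [Matrix.mulVec_mulVec, Matrix.nonsing_inv_mul _ hdet, Matrix.one_mulVec]
    exact (congrFun h1 ⟨j, by omega⟩).symm
  rw [hc, Finset.sum_mul]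
  refine (norm_sum_le_of_le (n := fun k => ‖V⁻¹ ⟨j, by omega⟩ k‖ * r) _ fun k _ => ?_).trans ?_
  · rw [norm_mul]
    exact mul_le_mul_of_nonneg_left (hval k) (norm_nonneg _)
  · rw [← Finset.sum_mul]
    exact Finset.single_le_sum (f := fun i => (∑ k, ‖V⁻¹ i k‖) * r)
      (fun i _ => mul_nonneg (Finset.sum_nonneg fun _ _ => norm_nonneg _) hr0) (Finset.mem_univ _)

/-- Restricted to the line through `x/2`, `P` is a scalar polynomial with controlled coefficients,
evaluated at 2. The radius 2 is that of the points `x + t e_k` with `x` in the ball and `|t| ≤ 1`.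
-/
theorem PolyDegLE.exists_norm_apply_le_of_norm_le_two (𝕜 X : Type*) [RCLike 𝕜]
    [NormedAddCommGroup X] [NormedSpace 𝕜 X] (N : ℕ) :
    ∃ B : ℝ, 0 ≤ B ∧ ∀ (P : PolyDegLE 𝕜 X N) (x : X), ‖x‖ ≤ 2 → ‖P x‖ ≤ B * ‖P‖ := by
  obtain ⟨C, hC, hcoeff⟩ := exists_coeff_le 𝕜 N
  refine ⟨∑ j ∈ Finset.range (N + 1), 2 ^ j * C, by positivity, fun P x hx => ?_⟩
  obtain ⟨Q, hQ, hP⟩ := P.2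
  have hy : ‖(2 : 𝕜)⁻¹ • x‖ ≤ 1 := by
    rw [norm_smul, norm_inv, RCLike.norm_ofNat]
    linarith
  have hxy : x = (2 : 𝕜) • ((2 : 𝕜)⁻¹ • x) := by rw [smul_inv_smul₀ two_ne_zero]
  have hval : ∀ t : 𝕜, P (t • ((2 : 𝕜)⁻¹ • x)) =
      ∑ j ∈ Finset.range (N + 1), Q j ((2 : 𝕜)⁻¹ • x) * t ^ j := fun t => by
    rw [hP, Finset.sum_apply]
    exact Finset.sum_congr rfl fun j _ => by rw [(hQ j).map_smul, mul_comm]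
  have h := hcoeff (fun j => Q j ((2 : 𝕜)⁻¹ • x)) ‖P‖ fun t ht => by
    rw [← hval]
    refine P.norm_apply_le ?_
    rw [norm_smul]
    exact mul_le_one₀ ht (norm_nonneg _) hy
  rw [hxy, hval, Finset.sum_mul]
  refine norm_sum_le_of_le _ fun j hj => ?_
  rw [norm_mul, norm_pow, RCLike.norm_ofNat, mul_comm, mul_assoc]
  exact mul_le_mul_of_nonneg_left (h j (by simpa [Nat.lt_succ_iff] using hj)) (by positivity)

theorem decRearrangement_antitone {𝕜 : Type*} [RCLike 𝕜] {x : ℕ → 𝕜} {C : ℝ}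
    (hC : ∀ i, ‖x i‖ ≤ C) : Antitone (decRearrangement x) := fun m n hmn => by
  refine csInf_le_csInf ⟨0, fun t ht => ht.1⟩ ⟨C, (norm_nonneg _).trans (hC 0), ?_⟩
    fun t ht => ⟨ht.1, ht.2.trans (Nat.cast_le.2 hmn)⟩
  have : {i : ℕ | C < ‖x i‖} = ∅ := by
    ext i
    simpa using hC i
  simp [this]

theorem sum_pow_le_sum_decRearrangement_pow {𝕜 : Type*} [RCLike 𝕜] {x : ℕ → 𝕜} {C : ℝ}
    (hC : ∀ i, ‖x i‖ ≤ C) (m : ℕ) : ∀ (n : ℕ) (A : Finset ℕ), A.card = n →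
      ∑ i ∈ A, ‖x i‖ ^ m ≤ ∑ i ∈ Finset.range n, decRearrangement x i ^ m := by
  intro n
  induction n with
  | zero =>
    intro A hA
    simp [Finset.card_eq_zero.mp hA]
  | succ n ih =>
    intro A hA
    have hne : A.Nonempty := Finset.card_pos.mp (by omega)
    obtain ⟨j, hj, hmin⟩ := A.exists_min_image (fun i => ‖x i‖) hne
    have h1 : ‖x j‖ ≤ decRearrangement x n := le_decRearrangement hC n (by omega) hmin
    have h2 := ih (A.erase j) (by rw [Finset.card_erase_of_mem hj]; omega)
    rw [← Finset.sum_erase_add A _ hj, Finset.sum_range_succ]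
    exact add_le_add h2 (pow_le_pow_left₀ (norm_nonneg _) h1 m)

theorem AdmissibleSeq.sum_seq_le_W (w : AdmissibleSeq) (A : Finset ℕ) :
    ∑ i ∈ A, w.seq i ≤ w.W A.card := by
  induction A using Finset.induction_on_max with
  | empty => simp [AdmissibleSeq.W_zero]
  | insert a s hs ih =>
    have ha : a ∉ s := fun h => lt_irrefl _ (hs a h)
    have hcard : s.card ≤ a := by
      have : s ⊆ Finset.range a := fun x hx => Finset.mem_range.2 (hs x hx)
      simpa using Finset.card_le_card this
    rw [Finset.sum_insert ha, Finset.card_insert_of_notMem ha, w.W_succ, add_comm]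
    exact add_le_add ih (w.antitone hcard)

/-! ### Power sums when `w ∈ ℓ_m`. -/

namespace LorentzPredual

variable {𝕜 : Type*} [RCLike 𝕜] {w : AdmissibleSeq}

/-- The unit ball condition says that the partial sums of `x*` are dominated by those of `w`, so
majorization bounds the power sums. -/
theorem sum_norm_pow_le {x : LorentzPredual 𝕜 w} (hx : ‖x‖ ≤ 1) {m : ℕ}
    (hw : Summable fun i => w.seq i ^ (m + 1)) (A : Finset ℕ) :
    ∑ i ∈ A, ‖x.toSeq i‖ ^ (m + 1) ≤ ∑' i, w.seq i ^ (m + 1) := by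
  obtain ⟨C, hC⟩ := x.bounded_toSeq
  refine (sum_pow_le_sum_decRearrangement_pow hC (m + 1) _ A rfl).trans
    ((sum_pow_le_sum_pow_of_antitone (decRearrangement_antitone hC)
      (decRearrangement_nonneg _) w.nonneg (fun n => ?_) m _).trans
      (hw.sum_le_tsum _ fun i _ => pow_nonneg (w.nonneg i) _))
  rcases n with _ | n
  · simp
  · have h := (x.rearrangementSum_div_le_norm n).trans hx
    rwa [div_le_one (w.W_pos n)] at h

theorem exists_norm_le_one_smul_eq (x : LorentzPredual 𝕜 w) :
    ∃ y : LorentzPredual 𝕜 w, ‖y‖ ≤ 1 ∧ x = (‖x‖ : 𝕜) • y := by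
  rcases eq_or_ne x 0 with rfl | hx
  · exact ⟨0, by simp, by simp⟩
  · have hn : (‖x‖ : 𝕜) ≠ 0 := by simpa using hx
    refine ⟨(‖x‖ : 𝕜)⁻¹ • x, ?_, (smul_inv_smul₀ hn x).symm⟩
    rw [norm_smul, norm_inv, RCLike.norm_ofReal, abs_norm, inv_mul_cancel₀ (norm_ne_zero_iff.2 hx)]

/-- After normalization the product at each `k` is at most the largest factor to the power `m + 1`,
hence at most the sum of these powers over the slots. -/
theorem sum_prod_norm_le {m : ℕ} (hw : Summable fun i => w.seq i ^ (m + 1))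
    (x : Fin (m + 1) → LorentzPredual 𝕜 w) (A : Finset ℕ) :
    ∑ k ∈ A, ∏ i, ‖(x i).toSeq k‖ ≤
      ((m + 1 : ℕ) * ∑' i, w.seq i ^ (m + 1)) * ∏ i, ‖x i‖ := by
  choose y hy hxy using fun i => exists_norm_le_one_smul_eq (x i)
  have h1 : ∀ k i, ‖(x i).toSeq k‖ = ‖x i‖ * ‖(y i).toSeq k‖ := fun k i => by
    conv_lhs => rw [hxy i]
    rw [toSeq_smul_apply, norm_mul, RCLike.norm_ofReal, abs_norm]
  have h2 : ∀ k, ∏ i, ‖(y i).toSeq k‖ ≤ ∑ i, ‖(y i).toSeq k‖ ^ (m + 1) := fun k => by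
    obtain ⟨i₀, -, hi₀⟩ := Finset.exists_max_image Finset.univ (fun i => ‖(y i).toSeq k‖)
      Finset.univ_nonempty
    calc ∏ i, ‖(y i).toSeq k‖ ≤ ∏ _i : Fin (m + 1), ‖(y i₀).toSeq k‖ :=
          Finset.prod_le_prod (fun _ _ => norm_nonneg _) hi₀
      _ = ‖(y i₀).toSeq k‖ ^ (m + 1) := by simp
      _ ≤ _ := Finset.single_le_sum (f := fun i => ‖(y i).toSeq k‖ ^ (m + 1))
          (fun _ _ => by positivity) (Finset.mem_univ i₀)
  simp_rw [h1, Finset.prod_mul_distrib]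
  rw [← Finset.mul_sum, mul_comm]
  refine mul_le_mul_of_nonneg_right ?_ (Finset.prod_nonneg fun _ _ => norm_nonneg _)
  refine (Finset.sum_le_sum fun k _ => h2 k).trans ?_
  rw [Finset.sum_comm]
  refine (Finset.sum_le_sum fun i _ => sum_norm_pow_le (hy i) hw A).trans_eq ?_
  simp

theorem summable_prod_coord {m : ℕ} (hw : Summable fun i => w.seq i ^ (m + 1))
    (x : Fin (m + 1) → LorentzPredual 𝕜 w) : Summable fun k => ∏ i, (x i).toSeq k :=
  Summable.of_norm (summable_of_sum_le (fun _ => norm_nonneg _) fun A => by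
    simpa only [norm_prod] using sum_prod_norm_le hw x A)

/-- The form `(x₁, …, x_m) ↦ ∑ₖ x₁(k) ⋯ x_m(k)`, bounded if `w ∈ ℓ_m`. -/
noncomputable def diagForm (𝕜 : Type*) [RCLike 𝕜] {w : AdmissibleSeq} {m : ℕ}
    (hw : Summable fun i => w.seq i ^ (m + 1)) :
    ContinuousMultilinearMap 𝕜 (fun _ : Fin (m + 1) => LorentzPredual 𝕜 w) 𝕜 :=
  let F : ℕ → MultilinearMap 𝕜 (fun _ : Fin (m + 1) => LorentzPredual 𝕜 w) 𝕜 := fun k =>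
    (MultilinearMap.mkPiAlgebra 𝕜 (Fin (m + 1)) 𝕜).compLinearMap fun _ => coord k
  have hF : ∀ x, Summable fun k => F k x := summable_prod_coord hw
  MultilinearMap.mkContinuous
    { toFun := fun x => ∑' k, F k x
      map_update_add' := fun x i a b => by
        rw [← (hF _).tsum_add (hF _)]
        exact tsum_congr fun k => (F k).map_update_add x i a b
      map_update_smul' := fun x i c a => by
        rw [smul_eq_mul, ← tsum_mul_left]
        exact tsum_congr fun k => (F k).map_update_smul x i c a }
    ((m + 1 : ℕ) * ∑' i, w.seq i ^ (m + 1)) fun x => by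
      have h1 := summable_of_sum_le (f := fun k => ‖∏ i, (x i).toSeq k‖) (fun _ => norm_nonneg _)
        fun A => by simpa only [norm_prod] using sum_prod_norm_le hw x A
      refine (norm_tsum_le_tsum_norm h1).trans (h1.tsum_le_of_sum_le fun A => ?_)
      simpa only [F, coord, norm_prod] using sum_prod_norm_le hw x A

theorem diagForm_apply_const {m : ℕ} (hw : Summable fun i => w.seq i ^ (m + 1))
    (x : LorentzPredual 𝕜 w) : (diagForm 𝕜 hw fun _ => x) = ∑' k, x.toSeq k ^ (m + 1) := by
  refine tsum_congr fun k => ?_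
  change ∏ _i : Fin (m + 1), x.toSeq k = _
  simp

theorem summable_norm_pow {x : LorentzPredual 𝕜 w} (hx : ‖x‖ ≤ 1) {m : ℕ}
    (hw : Summable fun i => w.seq i ^ (m + 1)) : Summable fun k => ‖x.toSeq k ^ (m + 1)‖ :=
  summable_of_sum_le (fun _ => norm_nonneg _) fun A => by
    simpa only [norm_pow] using sum_norm_pow_le hx hw A

theorem norm_tsum_pow_le {x : LorentzPredual 𝕜 w} (hx : ‖x‖ ≤ 1) {m : ℕ}
    (hw : Summable fun i => w.seq i ^ (m + 1)) :
    ‖∑' k, x.toSeq k ^ (m + 1)‖ ≤ ∑' i, w.seq i ^ (m + 1) := by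
  have h := summable_norm_pow hx hw
  refine (norm_tsum_le_tsum_norm h).trans (h.tsum_le_of_sum_le fun A => ?_)
  simpa only [norm_pow] using sum_norm_pow_le hx hw A

/-! ### Expansion along unit vectors. -/

/-- With the slots outside `s` frozen at `x`, this is a form of degree `s.card` evaluated far out.
-/
theorem tendsto_form_unitVec {j : ℕ}
    (Φ : ContinuousMultilinearMap 𝕜 (fun _ : Fin j => LorentzPredual 𝕜 w) 𝕜) (s : Finset (Fin j))
    (hs : s.Nonempty) (hw : ¬ Summable fun i => w.seq i ^ s.card) {x : LorentzPredual 𝕜 w}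
    (hx : ‖x‖ ≤ 1) :
    Tendsto (fun k => Φ (s.piecewise (fun _ => unitVec k) fun _ => x)) atTop (𝓝 0) := by
  rw [NormedAddGroup.tendsto_nhds_zero]
  intro ε hε
  have : Nonempty {a // a ∈ s} := hs.to_subtype
  obtain ⟨n, hn⟩ := exists_norm_le_of_tails_aux
    (Φ.toMultilinearMap.domDomRestrict (· ∈ s) fun _ => x) (norm_nonneg Φ)
    (norm_domDomRestrict_le (norm_nonneg Φ) (fun x => Φ.le_opNorm x) _ _ fun _ => hx)
    (by simpa using hw) ∅ 0 (half_pos hε)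
  filter_upwards [eventually_ge_atTop n] with k hk
  have h := hn (fun _ => unitVec k) (fun _ => norm_unitVec_le k) (fun _ j hj => by
    rw [toSeq_unitVec, if_neg (by omega)]) (by simp)
  refine lt_of_le_of_lt (le_of_eq_of_le ?_ h) (half_lt_self hε)
  rw [MultilinearMap.domDomRestrict_apply]
  congr 2

theorem exists_expansion_homogeneous {j N : ℕ} (hj : j ≤ N) {P : LorentzPredual 𝕜 w → 𝕜}
    (hP : IsHomogeneousPoly 𝕜 j P) {x : LorentzPredual 𝕜 w} (hx : ‖x‖ ≤ 1) :
    ∃ d : ℕ → ℕ → 𝕜, (∀ k t, P (x + t • unitVec k) =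
      ∑ l ∈ Finset.range (N + 1), d l k * t ^ l) ∧
      ∀ l, 1 ≤ l → (¬ Summable fun i => w.seq i ^ l) → Tendsto (d l) atTop (𝓝 0) := by
  obtain ⟨Φ, hΦ⟩ := hP
  refine ⟨fun l k => ∑ s : Finset (Fin j), if s.card = l then
    Φ (s.piecewise (fun _ => unitVec k) fun _ => x) else 0, fun k t => ?_, fun l hl hw => ?_⟩
  · have hadd : (fun _ : Fin j => x + t • (unitVec k : LorentzPredual 𝕜 w)) =
        (fun _ => t • unitVec k) + fun _ => x := funext fun _ => add_comm _ _
    rw [hΦ, hadd, Φ.map_add_univ]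
    simp_rw [Finset.sum_mul]
    rw [Finset.sum_comm]
    refine Finset.sum_congr rfl fun s _ => ?_
    have hcard : s.card < N + 1 := by
      have := Finset.card_le_univ s
      rw [Fintype.card_fin] at this
      omega
    have h1 : s.piecewise (fun _ => t • (unitVec k : LorentzPredual 𝕜 w)) (fun _ => x) =
        s.piecewise (fun i => t • s.piecewise (fun _ => unitVec k) (fun _ => x) i)
          (s.piecewise (fun _ => unitVec k) fun _ => x) := by
      funext i
      by_cases hi : i ∈ s <;> simp [hi]
    rw [h1, Φ.map_piecewise_smul (fun _ => t)]
    simp_rw [ite_mul, zero_mul]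
    rw [Finset.sum_ite_eq, if_pos (Finset.mem_range.2 hcard), Finset.prod_const, smul_eq_mul,
      mul_comm]
  · rw [show 𝓝 (0 : 𝕜) = 𝓝 (∑ _s : Finset (Fin j), 0) by simp]
    refine tendsto_finsetSum _ fun s _ => ?_
    by_cases hsl : s.card = l
    · simp only [hsl, if_true]
      exact tendsto_form_unitVec Φ s (Finset.card_pos.1 (by omega)) (hsl ▸ hw) hx
    · simp only [hsl, if_false]
      exact tendsto_const_nhds

/-- The expansion of a polynomial along the unit vectors; the coefficients of those degrees `l` for
which `w ∉ ℓ_l` tend to zero. -/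
theorem exists_expansion {N : ℕ} (P : PolyDegLE 𝕜 (LorentzPredual 𝕜 w) N) {x : LorentzPredual 𝕜 w}
    (hx : ‖x‖ ≤ 1) : ∃ d : ℕ → ℕ → 𝕜, (∀ k t, P (x + t • unitVec k) =
      ∑ l ∈ Finset.range (N + 1), d l k * t ^ l) ∧
      ∀ l, 1 ≤ l → (¬ Summable fun i => w.seq i ^ l) → Tendsto (d l) atTop (𝓝 0) := by
  obtain ⟨Q, hQ, hP⟩ := P.2
  have h : ∀ j, ∃ d : ℕ → ℕ → 𝕜, j ≤ N → (∀ k t, Q j (x + t • unitVec k) =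
      ∑ l ∈ Finset.range (N + 1), d l k * t ^ l) ∧
      ∀ l, 1 ≤ l → (¬ Summable fun i => w.seq i ^ l) → Tendsto (d l) atTop (𝓝 0) := fun j => by
    by_cases hj : j ≤ N
    · exact (exists_expansion_homogeneous hj (hQ j) hx).imp fun _ h _ => h
    · exact ⟨0, fun h => absurd h hj⟩
  choose d hd using h
  have hmem : ∀ j ∈ Finset.range (N + 1), j ≤ N := fun j hj =>
    Nat.lt_succ_iff.1 (Finset.mem_range.1 hj)
  refine ⟨fun l k => ∑ j ∈ Finset.range (N + 1), d j l k, fun k t => ?_, fun l hl hw => ?_⟩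
  · rw [hP, Finset.sum_apply]
    simp_rw [Finset.sum_mul]
    rw [Finset.sum_comm]
    exact Finset.sum_congr rfl fun j hj => (hd j (hmem j hj)).1 k t
  · rw [← Finset.sum_const_zero (s := Finset.range (N + 1))]
    exact tendsto_finsetSum _ fun j hj => (hd j (hmem j hj)).2 l hl hw

/-! ### A polynomial not approximable by norm-attaining ones. -/

/-- The polynomial `1 + ∑ₖ x(k)ᵐ⁺¹`. -/
noncomputable def onePlusPowerSum (𝕜 : Type*) [RCLike 𝕜] {w : AdmissibleSeq} {m N : ℕ}
    (hw : Summable fun i => w.seq i ^ (m + 1)) (hm : m + 1 ≤ N) :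
    PolyDegLE 𝕜 (LorentzPredual 𝕜 w) N :=
  ⟨fun x => 1 + ∑' k, x.toSeq k ^ (m + 1), by
    refine ⟨fun j => if j = 0 then fun _ => 1 else if j = m + 1 then
      (fun x => ∑' k, x.toSeq k ^ (m + 1)) else 0, fun j => ?_, ?_⟩
    · by_cases h0 : j = 0
      · subst h0
        exact ⟨ContinuousMultilinearMap.constOfIsEmpty 𝕜 _ 1, fun x => by simp⟩
      · simp only [h0, if_false]
        by_cases h1 : j = m + 1
        · subst h1
          exact ⟨diagForm 𝕜 hw, fun x => by rw [if_pos rfl, diagForm_apply_const]⟩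
        · exact ⟨0, fun x => by simp [h1]⟩
    · funext x
      rw [Finset.sum_apply, Finset.sum_range_succ', Finset.sum_eq_single_of_mem m
        (by simpa using hm) fun j _ hj => by simp [hj]]
      simp [add_comm]⟩

theorem onePlusPowerSum_apply {m N : ℕ} (hw : Summable fun i => w.seq i ^ (m + 1))
    (hm : m + 1 ≤ N) (x : LorentzPredual 𝕜 w) :
    onePlusPowerSum 𝕜 hw hm x = 1 + ∑' k, x.toSeq k ^ (m + 1) := rfl

theorem one_add_tsum_le_norm_onePlusPowerSum {m N : ℕ}
    (hw : Summable fun i => w.seq i ^ (m + 1)) (hm : m + 1 ≤ N) :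
    1 + ∑' i, w.seq i ^ (m + 1) ≤ ‖onePlusPowerSum 𝕜 hw hm‖ := by
  have h1 : ∀ n, 1 + ∑ i ∈ Finset.range n, w.seq i ^ (m + 1) ≤ ‖onePlusPowerSum 𝕜 hw hm‖ := by
    intro n
    -- Truncations of `w` itself lie in the unit ball and their power sums exhaust the series.
    let x : LorentzPredual 𝕜 w := ∑ k ∈ Finset.range n, ((w.seq k : ℝ) : 𝕜) • unitVec k
    have hxi : ∀ i, x.toSeq i = if i ∈ Finset.range n then ((w.seq i : ℝ) : 𝕜) else 0 := fun i => by
      simp [x, toSeq_sum, toSeq_unitVec]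
    have hx : ‖x‖ ≤ 1 := norm_le_of_sum_le fun A _ => by
      rw [one_mul]
      refine (Finset.sum_le_sum fun i _ => ?_).trans (w.sum_seq_le_W A)
      rw [hxi]
      split_ifs
      · rw [RCLike.norm_ofReal, abs_of_nonneg (w.nonneg i)]
      · simpa using w.nonneg i
    refine le_trans ?_ (PolyDegLE.norm_apply_le _ hx)
    have hval : onePlusPowerSum 𝕜 hw hm x =
        ((1 + ∑ i ∈ Finset.range n, w.seq i ^ (m + 1) : ℝ) : 𝕜) := by
      rw [onePlusPowerSum_apply, tsum_eq_sum (s := Finset.range n) fun i hi => by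
        rw [hxi, if_neg hi, zero_pow (Nat.succ_ne_zero m)]]
      push_cast
      refine congrArg _ (Finset.sum_congr rfl fun i hi => ?_)
      rw [hxi, if_pos hi]
    rw [hval, RCLike.norm_ofReal]
    exact le_abs_self _
  exact le_of_tendsto' (hw.hasSum.tendsto_sum_nat.const_add 1) h1

theorem onePlusPowerSum_add_smul_unitVec_sub {m N : ℕ}
    (hw : Summable fun i => w.seq i ^ (m + 1)) (hm : m + 1 ≤ N) {x : LorentzPredual 𝕜 w} {t : 𝕜}
    {k : ℕ} (hx : ‖x‖ ≤ 1) (hxt : ‖x + t • unitVec k‖ ≤ 1) :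
    onePlusPowerSum 𝕜 hw hm (x + t • unitVec k) - onePlusPowerSum 𝕜 hw hm x =
      (x.toSeq k + t) ^ (m + 1) - x.toSeq k ^ (m + 1) := by
  rw [onePlusPowerSum_apply, onePlusPowerSum_apply, add_sub_add_left_eq_sub,
    ← (summable_norm_pow hxt hw).of_norm.tsum_sub (summable_norm_pow hx hw).of_norm,
    tsum_eq_single k fun i hi => by simp [toSeq_unitVec, hi]]
  simp [toSeq_unitVec]

/-- Near-equality in the triangle inequality for `1 + q` forces `q` towards the positive axis;
expanding the squares gives `2 re q ≥ S - 1`. -/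
theorem re_nonneg_of_le_norm_one_add {q : 𝕜} {S r : ℝ} (hS : 1 ≤ S) (hr : r ≤ 1 / 4)
    (hq : ‖q‖ ≤ S) (h : 1 + S - 2 * r ≤ ‖1 + q‖) : 0 ≤ RCLike.re q := by
  have h1 : ‖1 + q‖ ^ 2 = 1 + 2 * RCLike.re q + ‖q‖ ^ 2 := by
    have := norm_add_sq (𝕜 := 𝕜) (1 : 𝕜) q
    simpa using this
  have h2 : (1 + S - 2 * r) ^ 2 ≤ ‖1 + q‖ ^ 2 := pow_le_pow_left₀ (by linarith) h 2
  have h3 : ‖q‖ ^ 2 ≤ S ^ 2 := pow_le_pow_left₀ (norm_nonneg q) hq 2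
  nlinarith

theorem re_conj_mul_nonpos {c z : 𝕜} (h : ‖c + z‖ ≤ ‖c‖) :
    RCLike.re (z * (starRingEnd 𝕜) c) ≤ 0 := by
  have h1 := norm_add_sq (𝕜 := 𝕜) c z
  rw [RCLike.inner_apply] at h1
  have h2 : ‖c + z‖ ^ 2 ≤ ‖c‖ ^ 2 := pow_le_pow_left₀ (norm_nonneg _) h 2
  nlinarith [sq_nonneg ‖z‖]

/-- If `P` attains its norm at `x` and differs little from `1 + ∑ₖ x(k)ᵐ⁺¹`, where `m + 1` is the
least exponent with `w ∈ ℓ_{m+1}`, then flatness of the ball at `x` bounds the real part of `P x`. -/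
theorem re_le_of_normAttaining {m N : ℕ} (hw : Summable fun i => w.seq i ^ (m + 1))
    (hm : m + 1 ≤ N) (hmin : ∀ l ≤ m, ¬ Summable fun i => w.seq i ^ l)
    {P : PolyDegLE 𝕜 (LorentzPredual 𝕜 w) N} {x : LorentzPredual 𝕜 w} (hx : ‖x‖ ≤ 1)
    (hP : ‖P x‖ = ‖P‖) {C B : ℝ}
    (hC : ∀ (c : ℕ → 𝕜) (r : ℝ),
      (∀ t : 𝕜, ‖t‖ ≤ 1 → ‖∑ j ∈ Finset.range (N + 1), c j * t ^ j‖ ≤ r) →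
      ∀ j ≤ N, ‖c j‖ ≤ C * r)
    (hB : ∀ (D : PolyDegLE 𝕜 (LorentzPredual 𝕜 w) N) (x), ‖x‖ ≤ 2 → ‖D x‖ ≤ B * ‖D‖) :
    RCLike.re (P x) ≤
      ‖P x‖ * ((N + 1) * (C * (B * ‖P - onePlusPowerSum 𝕜 hw hm‖))) := by
  set D := P - onePlusPowerSum 𝕜 hw hm with hD
  obtain ⟨δ, hδ, hδ1, hflat⟩ := exists_norm_add_smul_unitVec_le hx
  obtain ⟨d, hd, hd0⟩ := exists_expansion D hx
  set E : ℝ := C * (B * ‖D‖) with hE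
  have hdE : ∀ k, ∀ l ≤ N, ‖d l k‖ ≤ E := fun k => hC (fun l => d l k) _ fun t ht => by
    rw [← hd]
    refine hB D _ ((norm_add_le _ _).trans ?_)
    have : ‖t • (unitVec k : LorentzPredual 𝕜 w)‖ ≤ 1 := by
      rw [norm_smul]
      exact mul_le_one₀ ht (norm_nonneg _) (norm_unitVec_le k)
    linarith
  have hE0 : 0 ≤ E := (norm_nonneg _).trans (hdE 0 0 (Nat.zero_le N))
  -- The part of the increment that vanishes as `k → ∞`: the cross terms of the power, since `x(k) →
  -- 0`, and the terms of `D` of degree `1, …, m`, by minimality of `m + 1`.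
  let u : ℕ → 𝕜 := fun k => ((x.toSeq k + (δ : 𝕜)) ^ (m + 1) - x.toSeq k ^ (m + 1) -
    (δ : 𝕜) ^ (m + 1)) + ∑ l ∈ Finset.range m, d (l + 1) k * (δ : 𝕜) ^ (l + 1)
  have hu : Tendsto u atTop (𝓝 0) := by
    have h1 : Tendsto (fun k => (x.toSeq k + (δ : 𝕜)) ^ (m + 1) - x.toSeq k ^ (m + 1) -
        (δ : 𝕜) ^ (m + 1)) atTop (𝓝 0) := by
      have := (((x.tendsto_coord.add_const (δ : 𝕜)).pow (m + 1)).sub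
        (x.tendsto_coord.pow (m + 1))).sub_const ((δ : 𝕜) ^ (m + 1))
      simpa using this
    have h2 : Tendsto (fun k => ∑ l ∈ Finset.range m, d (l + 1) k * (δ : 𝕜) ^ (l + 1)) atTop
        (𝓝 (∑ l ∈ Finset.range m, 0 * (δ : 𝕜) ^ (l + 1))) :=
      tendsto_finsetSum _ fun l hl => (hd0 (l + 1) (by omega)
        (hmin _ (by have := Finset.mem_range.1 hl; omega))).mul_const _
    simpa using h1.add h2
  have hsplit : ∀ k, D (x + (δ : 𝕜) • unitVec k) - D x =
      ∑ l ∈ Finset.range m, d (l + 1) k * (δ : 𝕜) ^ (l + 1) +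
      ∑ l ∈ Finset.range (N - m), d (m + l + 1) k * (δ : 𝕜) ^ (m + l + 1) := fun k => by
    -- At `t = 0` the expansion identifies its constant term with `D x`.
    have h0 := hd k 0
    rw [zero_smul, add_zero, Finset.sum_range_succ'] at h0
    simp only [pow_succ, mul_zero, Finset.sum_const_zero, zero_add, pow_zero, mul_one] at h0
    rw [hd, h0, Finset.sum_range_succ', pow_zero, mul_one, add_sub_cancel_right,
      ← Finset.sum_range_add (fun l => d (l + 1) k * (δ : 𝕜) ^ (l + 1)) m (N - m)]
    congr 2
    omega
  have htail : ∀ k, ‖∑ l ∈ Finset.range (N - m), d (m + l + 1) k * (δ : 𝕜) ^ (m + l + 1)‖ ≤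
      (N + 1) * E * δ ^ (m + 1) := fun k => by
    refine (norm_sum_le_of_le (n := fun _ => E * δ ^ (m + 1)) _ fun l hl => ?_).trans ?_
    · rw [norm_mul, norm_pow, RCLike.norm_ofReal, abs_of_pos hδ]
      have hl' := Finset.mem_range.1 hl
      exact mul_le_mul (hdE k _ (by omega)) (pow_le_pow_of_le_one hδ.le hδ1 (by omega))
        (by positivity) hE0
    · rw [Finset.sum_const, Finset.card_range, nsmul_eq_mul, mul_assoc ((N : ℝ) + 1)]
      have h1 : ((N - m : ℕ) : ℝ) ≤ N + 1 := by exact_mod_cast (by omega : N - m ≤ N + 1)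
      exact mul_le_mul_of_nonneg_right h1 (mul_nonneg hE0 (pow_nonneg hδ.le _))
  have hev : ∀ᶠ k in atTop, δ ^ (m + 1) * RCLike.re (P x) -
      ‖P x‖ * (‖u k‖ + (N + 1) * E * δ ^ (m + 1)) ≤ 0 := by
    filter_upwards [hflat] with k hk
    set v := ∑ l ∈ Finset.range (N - m), d (m + l + 1) k * (δ : 𝕜) ^ (m + l + 1) with hv
    have hz : P (x + (δ : 𝕜) • unitVec k) = P x + (((δ ^ (m + 1) : ℝ) : 𝕜) + (u k + v)) := by
      have h1 := hsplit k
      have h2 := onePlusPowerSum_add_smul_unitVec_sub hw hm hx hk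
      rw [hD, PolyDegLE.sub_apply, PolyDegLE.sub_apply] at h1
      simp only [u]
      push_cast
      linear_combination h1 + h2
    have h1 : ‖P x + (((δ ^ (m + 1) : ℝ) : 𝕜) + (u k + v))‖ ≤ ‖P x‖ := by
      rw [← hz, hP]
      exact P.norm_apply_le hk
    have h2 := re_conj_mul_nonpos h1
    rw [add_mul, map_add, RCLike.re_ofReal_mul, RCLike.conj_re] at h2
    have h3 : -(‖P x‖ * (‖u k‖ + (N + 1) * E * δ ^ (m + 1))) ≤
        RCLike.re ((u k + v) * (starRingEnd 𝕜) (P x)) := by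
      refine neg_le_of_abs_le ((RCLike.abs_re_le_norm _).trans ?_)
      rw [norm_mul, RCLike.norm_conj, mul_comm]
      exact mul_le_mul_of_nonneg_left
        ((norm_add_le _ _).trans (add_le_add_right (htail k) _)) (norm_nonneg _)
    linarith
  have hlim := le_of_tendsto (((hu.norm.add_const ((N + 1) * E * δ ^ (m + 1))).const_mul
    ‖P x‖).const_sub (δ ^ (m + 1) * RCLike.re (P x))) hev
  rw [norm_zero, zero_add] at hlim
  refine le_of_mul_le_mul_left ?_ (pow_pos hδ (m + 1))
  linarith

theorem not_dense_normAttaining {N : ℕ} (hw : Summable fun i => w.seq i ^ N) :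
    ¬ Dense {P : PolyDegLE 𝕜 (LorentzPredual 𝕜 w) N | P.NormAttaining} := by
  classical
  intro hdense
  have hex : ∃ M, Summable fun i => w.seq i ^ M := ⟨N, hw⟩
  obtain ⟨m, hm⟩ : ∃ m, Nat.find hex = m + 1 := by
    refine Nat.exists_eq_add_one.2 (Nat.pos_of_ne_zero fun h0 => ?_)
    have h := Nat.find_spec hex
    rw [h0] at h
    simp only [pow_zero, summable_const_iff, one_ne_zero] at h
  have hwm : Summable fun i => w.seq i ^ (m + 1) := hm ▸ Nat.find_spec hex
  have hmN : m + 1 ≤ N := hm ▸ Nat.find_min' hex hw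
  have hmin : ∀ l ≤ m, ¬ Summable fun i => w.seq i ^ l := fun l hl =>
    Nat.find_min hex (by omega)
  obtain ⟨C, hC0, hC⟩ := exists_coeff_le 𝕜 N
  obtain ⟨B, hB0, hB⟩ := PolyDegLE.exists_norm_apply_le_of_norm_le_two 𝕜 (LorentzPredual 𝕜 w) N
  set S := ∑' i, w.seq i ^ (m + 1) with hS
  have hS1 : 1 ≤ S := by
    have := hwm.le_tsum 0 fun i _ => pow_nonneg (w.nonneg i) _
    rwa [w.first, one_pow] at this
  -- Chosen so that `r ≤ 1/(2G)` makes the upper bound for the real part of `P x` at most 1/2,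
  -- against the lower bound 3/4. The summand 1 in `C * B + 1` only ensures `G > 0`.
  set G : ℝ := (2 + S) * ((N + 1) * (C * B + 1)) with hG
  have hGpos : 0 < G := by positivity
  obtain ⟨P, ⟨x, hx, hPx⟩, hdist⟩ := hdense.exists_dist_lt (onePlusPowerSum 𝕜 hwm hmN)
    (ε := min (1 / 4) (1 / (2 * G))) (by positivity)
  rw [dist_comm, dist_eq_norm] at hdist
  set R := onePlusPowerSum 𝕜 hwm hmN with hR
  set r := ‖P - R‖ with hr
  have hr0 : 0 ≤ r := norm_nonneg _
  have hr1 : r ≤ 1 / 4 := hdist.le.trans (min_le_left _ _)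
  have hr2 : r * (2 * G) ≤ 1 := by
    rw [← le_div_iff₀ (by positivity)]
    exact hdist.le.trans (min_le_right _ _)
  have hD : ‖P x - R x‖ ≤ r := (P - R).norm_apply_le hx
  have hq := norm_tsum_pow_le hx hwm
  have hRx : R x = 1 + ∑' k, x.toSeq k ^ (m + 1) := onePlusPowerSum_apply hwm hmN x
  set q := ∑' k, x.toSeq k ^ (m + 1) with hqdef
  have hPx_le : ‖P x‖ ≤ 2 + S := by
    have h1 : ‖R x‖ ≤ 1 + S := by
      rw [hRx]
      exact (norm_add_le _ _).trans (by rw [norm_one]; linarith)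
    have h2 := norm_sub_norm_le (P x) (R x)
    linarith
  -- One `r` is lost in passing from the norm of `R` to that of `P`, the other from `P x` back to `R
  -- x`.
  have hlow : 1 + S - 2 * r ≤ ‖1 + q‖ := by
    have h1 : 1 + S ≤ ‖R‖ := one_add_tsum_le_norm_onePlusPowerSum hwm hmN
    have h2 := norm_sub_norm_le R P
    rw [norm_sub_rev] at h2
    have h3 := norm_sub_norm_le (P x) (R x)
    rw [← hRx]
    linarith
  have hre : 3 / 4 ≤ RCLike.re (P x) := by
    have h1 := re_nonneg_of_le_norm_one_add hS1 hr1 hq hlow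
    have h2 := (abs_le.1 ((RCLike.abs_re_le_norm (P x - R x)).trans hD)).1
    rw [map_sub, hRx, map_add, RCLike.one_re] at h2
    linarith
  have hle := re_le_of_normAttaining hwm hmN hmin hx hPx hC hB
  have hfin : ‖P x‖ * ((N + 1) * (C * (B * r))) ≤ r * G := by
    calc ‖P x‖ * ((N + 1) * (C * (B * r))) ≤ (2 + S) * ((N + 1) * (C * (B * r))) :=
          mul_le_mul_of_nonneg_right hPx_le (by positivity)
      _ ≤ (2 + S) * ((N + 1) * (C * (B * r) + r)) := by
          refine mul_le_mul_of_nonneg_left (mul_le_mul_of_nonneg_left ?_ (by positivity))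
            (by linarith)
          linarith
      _ = r * G := by rw [hG]; ring
  linarith

end LorentzPredual

theorem mainTheorem6 (𝕜 : Type*) [RCLike 𝕜] (w : AdmissibleSeq) (N : ℕ) (hN : 1 ≤ N) :
    Dense {P : PolyDegLE 𝕜 (LorentzPredual 𝕜 w) N | P.NormAttaining} ↔
      ¬ Memℓp w.seq (N : ENNReal) := by
  have hiff : Memℓp w.seq (N : ENNReal) ↔ Summable fun i => w.seq i ^ N := by
    rw [memℓp_gen_iff (by simpa using (by omega : 0 < N))]
    refine summable_congr fun i => ?_
    rw [ENNReal.toReal_natCast, Real.rpow_natCast, Real.norm_of_nonneg (w.nonneg i)]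
  rw [hiff]
  exact ⟨fun h hw => LorentzPredual.not_dense_normAttaining hw h,
    LorentzPredual.dense_normAttaining⟩
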